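/- **Definitions.** Let $X$ be a Hausdorff space. A *local uniformizing system* (l.u.s.) for an open subset $U\subset X$ is a triple $(\tilde U,G,\varphi)$, where $\tilde U$ is a non-empty connected open subset of $\mathbb R^n$ for some $n$, $G$ is a finite group of diffeomorphisms of $\tilde U$ such that the fixed point set of every non-identity element has codimension $\ge 2$, and $\varphi\colon\tilde U\to U$ is a map that induces a homeomorphism $\tilde U/G\to U$. An *injection* $(\tilde U,G,\varphi)\to(\tilde U',G',\varphi')$ is a diffeomorphism $\lambda$ of $\tilde U$ onto an open subset of $\tilde U'$ with $\varphi=\varphi'\circ\lambda$. A *defining family* on $X$ is a set $\mathcal F$ of l.u.s.'s for open subsets of $X$ such that 1. the images $\varphi(\tilde U)$, $(\tilde U,G,\varphi)\in\mathcal F$, cover $X$, and if $p$ lies in two of these images $U_1,U_2$, then some image $U_3$ satisfies $p\in U_3\subset U_1\cap U_2$; 2. if $(\tilde U,G,\varphi),(\tilde U',G',\varphi')\in\mathcal F$ and $\varphi(\tilde U)\subset\varphi'(\tilde U')$, then there exists an injection from $(\tilde U,G,\varphi)$ to $(\tilde U',G',\varphi')$. Two defining families on $X$ are *directly equivalent*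 if some defining family on $X$ contains both, and *equivalent* if they are joined by a finite chain of direct equivalences. A *V-manifold structure* on $X$ is an equivalence class of defining families on $X$. Let $Y\subset X$ be open. For a defining family $\mathcal F$ on $X$, let $\mathcal F|_Y$ be the set of all l.u.s.'s $(\tilde U_Y,G_Y,\varphi|_{\tilde U_Y})$, where $(\tilde U,G,\varphi)\in\mathcal F$, $\tilde U_Y$ is a connected component of $\varphi^{-1}(Y)$, and $G_Y$ consists of the restrictions to $\tilde U_Y$ of those elements of $G$ that preserve $\tilde U_Y$. The *restriction* $\mathcal V|_Y$ of a V-manifold structure $\mathcal V$ on $X$ is the set of all defining families on $Y$ that are equivalent to a defining family contained in $\mathcal F|_Y$ for some $\mathcal F\in\mathcal V$. (In particular it contains $\mathcal F|_Y$ if this is itself a defining family.) **Proposition.** Let $M$ be a Hausdorff topological space and $\mathcal U$ an open cover of $M$. (0) If $Y\subset X$ are open subsets of $M$ and $\mathcal V$ is a V-manifold structure on $X$, then $\mathcal V|_Y$ is a V-manifold structure on $Y$. (1) If $\mathcal V,\mathcal V'$ are V-manifold structures on $M$ with $\mathcal V|_U=\mathcal V'|_U$ for all $U\in\mathcal U$,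 then $\mathcal V=\mathcal V'$. (2) Suppose that for each $U\in\mathcal U$ a V-manifold structure $\mathcal V_U$ on $U$ is given, and that $\mathcal V_U|_{U\cap U'}=\mathcal V_{U'}|_{U\cap U'}$ for all $U,U'\in\mathcal U$. Then there exists a unique V-manifold structure $\mathcal V$ on $M$ such that $\mathcal V|_U=\mathcal V_U$ for every $U\in\mathcal U$. -/

import Mathlib

open Set TopologicalSpace
open scoped Manifold ContDiff

namespace VMfd

/-- The model space `ℝⁿ`. -/
abbrev E (n : ℕ) : Type := EuclideanSpace ℝ (Fin n)

/-- The derivative at `x` of a self-map `g` of an open subset `D` of `ℝⁿ`. It does not depend on how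
`g` is extended to `ℝⁿ` outside `D` (here by the identity). -/
noncomputable def differential {n : ℕ} {D : Opens (E n)} (g : D → D) (x : D) : E n →L[ℝ] E n :=
  fderiv ℝ (Function.extend ((↑) : D → E n) (fun y => (g y : E n)) id) x

/-- A local uniformizing system `(Ũ, G, φ)` of dimension `n` for an open subset of `M`, namely for
the open subset `φ(Ũ)`. -/
structure LUS (M : Type*) [TopologicalSpace M] (n : ℕ) where
  /-- `Ũ`, a connected (in particular non-empty) open subset of `ℝⁿ` -/
  dom : Opens (E n)
  connected : IsConnected (dom : Set (E n))
  /-- `G`, a finite group of diffeomorphisms of `Ũ` (`G` contains the inverses of its elements) -/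
  G : Subgroup (Equiv.Perm dom)
  finite : Finite G
  smooth : ∀ g ∈ G, ContMDiff 𝓘(ℝ, E n) 𝓘(ℝ, E n) ∞ (g : dom → dom)
  /-- The fixed point set of each `g ≠ 1` has codimension at least two: it is a submanifold (as `g`
  has finite order), whose tangent space at `x` is the fixed space of the derivative of `g`. -/
  codim : ∀ g ∈ G, g ≠ 1 → ∀ x : dom, g x = x →
    Module.finrank ℝ (LinearMap.ker ((differential g x - ContinuousLinearMap.id ℝ (E n) :
      E n →L[ℝ] E n) : E n →ₗ[ℝ] E n)) + 2 ≤ n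
  /-- `φ` -/
  φ : dom → M
  /-- `φ` induces a homeomorphism of `Ũ/G` with an open subset of `M`: it is continuous and open,
  and its fibres are the orbits of `G`. -/
  continuous_φ : Continuous φ
  isOpenMap_φ : IsOpenMap φ
  fibres : ∀ x y : dom, φ x = φ y ↔ ∃ g ∈ G, g x = y

variable {M : Type*} [TopologicalSpace M]

/-- There is an injection from `L` to `L'`: a diffeomorphism `j` from `Ũ` onto an open subset `V`
of `Ũ'` such that `φ = φ' ∘ j`. -/
def LUS.Injects {m n : ℕ} (L : LUS M m) (L' : LUS M n) : Prop :=
  ∃ (V : Opens (E n)) (hV : V ≤ L'.dom) (j : Diffeomorph 𝓘(ℝ, E m) 𝓘(ℝ, E n) L.dom V ∞),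
    ∀ x : L.dom, L.φ x = L'.φ (Opens.inclusion hV (j x))

/-- `L'` is obtained from `L` by restriction to a connected component of `φ⁻¹(Y)`; its group
consists of the restrictions of those elements of `G` that preserve this component. -/
structure LUS.IsComponent {n : ℕ} (L' L : LUS M n) (Y : Opens M) : Prop where
  le : L'.dom ≤ L.dom
  component : ∃ x ∈ ((↑) '' (L.φ ⁻¹' (Y : Set M)) : Set (E n)),
    (L'.dom : Set (E n)) = connectedComponentIn ((↑) '' (L.φ ⁻¹' (Y : Set M))) x
  group : ∀ h : Equiv.Perm L'.dom,
    h ∈ L'.G ↔ ∃ g ∈ L.G, ∀ x : L'.dom, Opens.inclusion le (h x) = g (Opens.inclusion le x)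
  map : ∀ x : L'.dom, L'.φ x = L.φ (Opens.inclusion le x)

variable (M) in
/-- Local uniformizing systems of arbitrary dimension for open subsets of `M`. -/
abbrev Chart : Type _ := Σ n : ℕ, LUS M n

/-- The open set that is uniformized by a local uniformizing system. -/
def Chart.image (c : Chart M) : Set M := range c.2.φ

/-- A defining family on the open subspace `X` of `M`. The local uniformizing systems for open
subsets of `X` are those for open subsets of `M` whose image is contained in `X`. -/
structure DefiningFamily (X : Opens M) where
  charts : Set (Chart M)
  image_subset : ∀ c ∈ charts, c.image ⊆ X
  cover : ∀ p ∈ X, ∃ c ∈ charts, p ∈ c.image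
  refine' : ∀ c₁ ∈ charts, ∀ c₂ ∈ charts, ∀ p ∈ c₁.image ∩ c₂.image,
    ∃ c₃ ∈ charts, p ∈ c₃.image ∧ c₃.image ⊆ c₁.image ∩ c₂.image
  injects : ∀ c ∈ charts, ∀ c' ∈ charts, c.image ⊆ c'.image → c.2.Injects c'.2

/-- Two defining families are directly equivalent if some defining family contains both. -/
def DirectlyEquivalent {X : Opens M} (F F' : DefiningFamily X) : Prop :=
  ∃ H : DefiningFamily X, F.charts ⊆ H.charts ∧ F'.charts ⊆ H.charts

/-- Two defining families are equivalent if a chain of direct equivalences leads from one to the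
other. -/
def Equivalent {X : Opens M} (F F' : DefiningFamily X) : Prop :=
  Relation.ReflTransGen DirectlyEquivalent F F'

/-- `S` is an equivalence class of defining families on `X`. -/
def IsClass {X : Opens M} (S : Set (DefiningFamily X)) : Prop :=
  ∃ F : DefiningFamily X, S = {F' | Equivalent F F'}

/-- A V-manifold structure on the open subspace `X` of `M`: an equivalence class of defining
families. A V-manifold structure on `M` itself is the case `X = ⊤`. -/
@[ext]
structure VStructure (X : Opens M) where
  families : Set (DefiningFamily X)
  isClass : IsClass families

/-- The restriction `F|_Y`: all restrictions of members of `F` to connected components of the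
preimage of `Y`. (It need not satisfy the last condition of a defining family.) -/
def DefiningFamily.restrict {X : Opens M} (F : DefiningFamily X) (Y : Opens M) : Set (Chart M) :=
  {c | ∃ L : LUS M c.1, ⟨c.1, L⟩ ∈ F.charts ∧ c.2.IsComponent L Y}

/-- The restriction to `Y` of a V-manifold structure `V` on `X`: all defining families on `Y` that
are equivalent to one whose members belong to `F|_Y` for some defining family `F` of `V`. In
particular it contains `F|_Y` whenever `F|_Y` is a defining family. -/
def VStructure.restrict {X : Opens M} (V : VStructure X) (Y : Opens M) :
    Set (DefiningFamily Y) :=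
  {K | ∃ F ∈ V.families, ∃ K₀ : DefiningFamily Y, K₀.charts ⊆ F.restrict Y ∧ Equivalent K₀ K}

end VMfd

/-! Equivalence of defining families turns out to be a pointwise condition on `M`, and such
conditions restrict to open sets and glue over covers.

A lift (`IsLift`) is a smooth local diffeomorphism between the domains of two charts over the
identity of `M`; `GermIso L L' p` asks for one near some point above `p`. Composing with group
elements moves the points above `p` freely, so this relation is symmetric and transitive. Two
families on the same open set are equivalent exactly when any two of their members are
germ-isomorphic over every common point (`Compat`, `equivalent_iff`).

The substance is the passage from germs to injections. Two lifts on a connected set differ by one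
group element (`IsLift.exists_act_eq`): by Baire they do so on a dense open set, and the element
cannot jump because an element fixing a point with derivative the identity is trivial. Call a chart
good if its domain is star-shaped about a common fixed point of its group. A germ of a lift on a
good chart extends along segments to the whole domain (`exists_lift_of_starConvex`), and the fixed
point forces the result to be injective (`IsLift.injOn`). Hence good charts inject wherever they do
so locally (`Good.injects`), and every chart has arbitrarily small good restrictions
(`exists_good_sub`).

Consequently, all good charts compatible with a compatible cover form a defining family (`good`).
This family links compatible families, supplies small charts for restrictions, and glues structures.
-/

namespace VMfd

variable {M : Type*} [TopologicalSpace M]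

/-! ### Charts and their groups in terms of maps on `ℝⁿ` -/

/-- Smoothness of a map between open subsets of Euclidean spaces, in terms of an extension. -/
theorem contMDiff_iff_contDiffAt {m n : ℕ} {D : Opens (E m)} {D' : Opens (E n)} {f : D → D'}
    {F : E m → E n} (h : ∀ x : D, F x = f x) :
    ContMDiff 𝓘(ℝ, E m) 𝓘(ℝ, E n) ∞ f ↔ ∀ x ∈ D, ContDiffAt ℝ ∞ F x := by
  rw [← ContMDiff.subtypeVal_comp_iff]
  have : (Subtype.val ∘ f : D → E n) = fun x : D => F x := by
    ext1 x; exact (h x).symm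
  rw [this]
  constructor
  · intro H x hx
    exact contMDiffAt_iff_contDiffAt.1 (contMDiffAt_subtype_iff.1 (H ⟨x, hx⟩))
  · intro H x
    exact contMDiffAt_subtype_iff.2 (contMDiffAt_iff_contDiffAt.2 (H x x.2))

namespace LUS

variable {l m n : ℕ}

open Classical in
/-- The map `φ` as a partial function on `ℝⁿ`. -/
noncomputable def proj (L : LUS M n) (x : E n) : Option M :=
  if h : x ∈ L.dom then some (L.φ ⟨x, h⟩) else none

/-- A self-map of the domain, extended by the identity to `ℝⁿ`. -/
noncomputable def act (L : LUS M n) (g : Equiv.Perm L.dom) : E n → E n :=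
  Function.extend ((↑) : L.dom → E n) (fun y => (g y : E n)) id

theorem proj_coe (L : LUS M n) (x : L.dom) : L.proj x = some (L.φ x) := by
  simp [proj]

theorem proj_eq_some {L : LUS M n} {x : E n} {p : M} :
    L.proj x = some p ↔ ∃ h : x ∈ L.dom, L.φ ⟨x, h⟩ = p := by
  unfold proj; split_ifs with h <;> simp [h]

theorem mem_dom_of_proj {L : LUS M n} {x : E n} {p : M} (h : L.proj x = some p) : x ∈ L.dom :=
  (proj_eq_some.1 h).1

theorem exists_proj {L : LUS M n} {x : E n} (h : x ∈ L.dom) : ∃ p, L.proj x = some p :=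
  ⟨_, L.proj_coe ⟨x, h⟩⟩

/-- The value `none` marks the complement of the domain, so an equation between projections also
carries membership in the domains. -/
theorem mem_dom_of_proj_eq {L : LUS M n} {L' : LUS M m} {x : E n} {y : E m}
    (h : L.proj x = L'.proj y) (hy : y ∈ L'.dom) : x ∈ L.dom := by
  obtain ⟨p, hp⟩ := exists_proj hy
  exact mem_dom_of_proj (h.trans hp)

theorem mem_range {L : LUS M n} {p : M} : p ∈ range L.φ ↔ ∃ x, L.proj x = some p := by
  constructor
  · rintro ⟨x, rfl⟩; exact ⟨x, L.proj_coe x⟩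
  · rintro ⟨x, hx⟩; obtain ⟨h, rfl⟩ := proj_eq_some.1 hx; exact ⟨_, rfl⟩

theorem act_coe (L : LUS M n) (g : Equiv.Perm L.dom) (x : L.dom) : L.act g x = g x :=
  Subtype.val_injective.extend_apply _ _ x

theorem act_of_mem {L : LUS M n} (g : Equiv.Perm L.dom) {x : E n} (hx : x ∈ L.dom) :
    L.act g x = g ⟨x, hx⟩ :=
  L.act_coe g ⟨x, hx⟩

theorem act_of_notMem {L : LUS M n} (g : Equiv.Perm L.dom) {x : E n} (hx : x ∉ L.dom) :
    L.act g x = x := by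
  rw [act, Function.extend_apply']
  · rfl
  · rintro ⟨y, rfl⟩; exact hx y.2

theorem act_mem {L : LUS M n} (g : Equiv.Perm L.dom) {x : E n} (hx : x ∈ L.dom) :
    L.act g x ∈ L.dom := by
  rw [act_of_mem g hx]; exact (g _).2

theorem act_one (L : LUS M n) (x : E n) : L.act 1 x = x := by
  by_cases hx : x ∈ L.dom
  · rw [act_of_mem _ hx]; rfl
  · rw [act_of_notMem _ hx]

theorem act_mul (L : LUS M n) (g h : Equiv.Perm L.dom) (x : E n) :
    L.act (g * h) x = L.act g (L.act h x) := by
  by_cases hx : x ∈ L.dom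
  · rw [act_of_mem _ hx, act_of_mem h hx, act_coe]; rfl
  · rw [act_of_notMem _ hx, act_of_notMem h hx, act_of_notMem g hx]

theorem act_inv_act (L : LUS M n) (g : Equiv.Perm L.dom) (x : E n) :
    L.act g⁻¹ (L.act g x) = x := by
  rw [← act_mul, inv_mul_cancel, act_one]

theorem act_act_inv (L : LUS M n) (g : Equiv.Perm L.dom) (x : E n) :
    L.act g (L.act g⁻¹ x) = x := by
  rw [← act_mul, mul_inv_cancel, act_one]

theorem act_injective (L : LUS M n) (g : Equiv.Perm L.dom) : Function.Injective (L.act g) :=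
  Function.LeftInverse.injective (L.act_inv_act g)

theorem proj_act {L : LUS M n} {g : Equiv.Perm L.dom} (hg : g ∈ L.G) (x : E n) :
    L.proj (L.act g x) = L.proj x := by
  by_cases hx : x ∈ L.dom
  · rw [act_of_mem _ hx, proj_coe, show L.proj x = _ from L.proj_coe ⟨x, hx⟩]
    exact congrArg some ((L.fibres _ _).2 ⟨g⁻¹, inv_mem hg, by simp⟩)
  · rw [act_of_notMem _ hx]

theorem exists_act_eq {L : LUS M n} {x y : E n} (hx : x ∈ L.dom) (h : L.proj y = L.proj x) :
    ∃ g ∈ L.G, L.act g x = y := by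
  have hy : y ∈ L.dom := mem_dom_of_proj_eq h hx
  rw [show L.proj x = _ from L.proj_coe ⟨x, hx⟩, show L.proj y = _ from L.proj_coe ⟨y, hy⟩] at h
  obtain ⟨g, hg, hgx⟩ := (L.fibres ⟨x, hx⟩ ⟨y, hy⟩).1 (Option.some_injective _ h).symm
  exact ⟨g, hg, by rw [act_of_mem g hx, hgx]⟩

theorem contDiffAt_act {L : LUS M n} {g : Equiv.Perm L.dom} (hg : g ∈ L.G) {x : E n}
    (hx : x ∈ L.dom) : ContDiffAt ℝ ∞ (L.act g) x :=
  (contMDiff_iff_contDiffAt (L.act_coe g)).1 (L.smooth g hg) x hx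

/-- This is how the codimension condition enters the argument: the isotropy group of a point acts
faithfully on the tangent space. -/
theorem eq_one_of_fderiv {L : LUS M n} {g : Equiv.Perm L.dom} (hg : g ∈ L.G) {x : E n}
    (hx : x ∈ L.dom) (hgx : L.act g x = x)
    (hd : fderiv ℝ (L.act g) x = ContinuousLinearMap.id ℝ (E n)) : g = 1 := by
  by_contra h1
  have := L.codim g hg h1 ⟨x, hx⟩ (Subtype.ext (by rw [← act_of_mem g hx, hgx]))
  -- Both sides extend `g` by the identity outside the domain, so they agree by definition.
  have hz : differential g ⟨x, hx⟩ = ContinuousLinearMap.id ℝ (E n) := hd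
  rw [hz, sub_self, ContinuousLinearMap.toLinearMap_zero, LinearMap.ker_zero, finrank_top] at this
  simp at this

/-! ### Lifts of the identity of `M` -/

/-- `f` is a smooth local diffeomorphism on the open set `V`, over the identity of `M`. -/
structure IsLift (L : LUS M m) (L' : LUS M n) (V : Set (E m)) (f : E m → E n) : Prop where
  isOpen : IsOpen V
  subset : V ⊆ L.dom
  proj_eq : ∀ x ∈ V, L'.proj (f x) = L.proj x
  contDiffAt : ∀ x ∈ V, ContDiffAt ℝ ∞ f x
  deriv : ∀ x ∈ V, ∃ e : E m ≃L[ℝ] E n, HasFDerivAt f (e : E m →L[ℝ] E n) x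

namespace IsLift

variable {L : LUS M l} {L' : LUS M m} {L'' : LUS M n} {V V' : Set (E l)} {f h : E l → E m}

theorem mem_dom (H : IsLift L L' V f) {x : E l} (hx : x ∈ V) : f x ∈ L'.dom :=
  mem_dom_of_proj_eq (H.proj_eq x hx) (H.subset hx)

theorem mono (H : IsLift L L' V f) (hV : V' ⊆ V) (ho : IsOpen V') : IsLift L L' V' f :=
  ⟨ho, hV.trans H.subset, fun x hx => H.proj_eq x (hV hx), fun x hx => H.contDiffAt x (hV hx),
    fun x hx => H.deriv x (hV hx)⟩

theorem continuousAt (H : IsLift L L' V f) {x : E l} (hx : x ∈ V) : ContinuousAt f x :=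
  (H.contDiffAt x hx).continuousAt

theorem continuousOn (H : IsLift L L' V f) : ContinuousOn f V :=
  fun _ hx => (H.continuousAt hx).continuousWithinAt

/-- A map that agrees locally with lifts is a lift. -/
theorem of_local (hV : IsOpen V)
    (H : ∀ x ∈ V, ∃ W h, IsLift L L' W h ∧ x ∈ W ∧ ∀ᶠ y in nhds x, f y = h y) :
    IsLift L L' V f := by
  refine ⟨hV, fun x hx => ?_, fun x hx => ?_, fun x hx => ?_, fun x hx => ?_⟩ <;>
    obtain ⟨W, h, hl, hxW, he⟩ := H x hx
  · exact hl.subset hxW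
  · rw [he.self_of_nhds]; exact hl.proj_eq x hxW
  · exact (hl.contDiffAt x hxW).congr_of_eventuallyEq he
  · obtain ⟨e, hd⟩ := hl.deriv x hxW
    exact ⟨e, hd.congr_of_eventuallyEq he⟩

theorem comp {V' : Set (E m)} {k : E m → E n} (H : IsLift L L' V f) (H' : IsLift L' L'' V' k) :
    IsLift L L'' (V ∩ f ⁻¹' V') (k ∘ f) := by
  refine ⟨H.continuousOn.isOpen_inter_preimage H.isOpen H'.isOpen, fun x hx => H.subset hx.1,
    fun x hx => (H'.proj_eq _ hx.2).trans (H.proj_eq x hx.1),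
    fun x hx => (H'.contDiffAt _ hx.2).comp x (H.contDiffAt x hx.1), fun x hx => ?_⟩
  obtain ⟨e, he⟩ := H.deriv x hx.1
  obtain ⟨e', he'⟩ := H'.deriv _ hx.2
  exact ⟨e.trans e', he'.comp x he⟩

theorem comp_of_mapsTo {V' : Set (E m)} {k : E m → E n} (H : IsLift L L' V f)
    (H' : IsLift L' L'' V' k) (hm : MapsTo f V V') : IsLift L L'' V (k ∘ f) :=
  (H.comp H').mono (fun _ hx => ⟨hx, hm hx⟩) H.isOpen

end IsLift

theorem isLift_id {L L' : LUS M n} {V : Set (E n)} (hV : IsOpen V) (hs : V ⊆ L.dom)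
    (h : ∀ x ∈ V, L'.proj x = L.proj x) : IsLift L L' V id :=
  ⟨hV, hs, h, fun _ _ => contDiffAt_id, fun x _ => ⟨ContinuousLinearEquiv.refl ℝ _, hasFDerivAt_id x⟩⟩

theorem isLift_act {L : LUS M n} {g : Equiv.Perm L.dom} (hg : g ∈ L.G) :
    IsLift L L L.dom (L.act g) := by
  refine ⟨L.dom.isOpen, subset_rfl, fun x _ => proj_act hg x, fun x hx => contDiffAt_act hg hx,
    fun x hx => ?_⟩
  have h1 : HasFDerivAt (L.act g) (fderiv ℝ (L.act g) x) x :=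
    ((contDiffAt_act hg hx).differentiableAt (by simp)).hasFDerivAt
  have h2 : HasFDerivAt (L.act g⁻¹) (fderiv ℝ (L.act g⁻¹) (L.act g x)) (L.act g x) :=
    ((contDiffAt_act (inv_mem hg) (act_mem g hx)).differentiableAt (by simp)).hasFDerivAt
  have h12 := h2.comp x h1
  have e1 : L.act g⁻¹ ∘ L.act g = id := funext (L.act_inv_act g)
  have h1' : HasFDerivAt (L.act g) (fderiv ℝ (L.act g) x) (L.act g⁻¹ (L.act g x)) := by
    rwa [act_inv_act]
  have h21 := h1'.comp (L.act g x) h2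
  have e2 : L.act g ∘ L.act g⁻¹ = id := funext (L.act_act_inv g)
  rw [e1] at h12
  rw [e2] at h21
  have i12 := h12.unique (hasFDerivAt_id x)
  have i21 := h21.unique (hasFDerivAt_id _)
  refine ⟨ContinuousLinearEquiv.equivOfInverse (fderiv ℝ (L.act g) x)
    (fderiv ℝ (L.act g⁻¹) (L.act g x)) (fun v => ?_) (fun v => ?_), ?_⟩
  · exact DFunLike.congr_fun i12 v
  · exact DFunLike.congr_fun i21 v
  · convert! h1

theorem IsLift.act_comp {L : LUS M m} {L' : LUS M n} {V : Set (E m)} {f : E m → E n}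
    (H : IsLift L L' V f) {g : Equiv.Perm L'.dom} (hg : g ∈ L'.G) :
    IsLift L L' V (L'.act g ∘ f) :=
  H.comp_of_mapsTo (isLift_act hg) fun _ hx => H.mem_dom hx

/-- The inverse function theorem for lifts. -/
theorem IsLift.exists_localHomeo {L : LUS M m} {L' : LUS M n} {V : Set (E m)} {f : E m → E n}
    (H : IsLift L L' V f) {x : E m} (hx : x ∈ V) :
    ∃ e : OpenPartialHomeomorph (E m) (E n), x ∈ e.source ∧ e.source ⊆ V ∧ (∀ y, e y = f y) ∧
      IsLift L' L e.target e.symm := by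
  obtain ⟨e', he'⟩ := H.deriv x hx
  let e₀ := (H.contDiffAt x hx).toOpenPartialHomeomorph f he' (by simp)
  have hx₀ : x ∈ e₀.source := (H.contDiffAt x hx).mem_toOpenPartialHomeomorph_source he' (by simp)
  let e := e₀.restrOpen V H.isOpen
  have hsrc : e.source ⊆ V := by
    intro y hy; rw [OpenPartialHomeomorph.restrOpen_source] at hy; exact hy.2
  have hef : ∀ y, e y = f y := fun y => rfl
  refine ⟨e, ?_, hsrc, hef, e.open_target, fun y hy => ?_, fun y hy => ?_, fun y hy => ?_,
    fun y hy => ?_⟩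
  · rw [OpenPartialHomeomorph.restrOpen_source]; exact ⟨hx₀, hx⟩
  · have := H.mem_dom (hsrc (e.map_target hy))
    rwa [← hef, e.right_inv hy] at this
  · rw [← H.proj_eq _ (hsrc (e.map_target hy)), ← hef, e.right_inv hy]
  · obtain ⟨d, hd⟩ := H.deriv _ (hsrc (e.map_target hy))
    exact e.contDiffAt_symm hy hd (H.contDiffAt _ (hsrc (e.map_target hy)))
  · obtain ⟨d, hd⟩ := H.deriv _ (hsrc (e.map_target hy))
    exact ⟨d.symm, e.hasFDerivAt_symm hy hd⟩

end LUS

/-! ### Rigidity of lifts -/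

/-- Two smooth maps that agree on an open set have the same value and derivative at each point of
its closure. -/
theorem eq_of_eqOn_of_mem_closure {m n : ℕ} {f h : E m → E n} {A : Set (E m)} {x : E m}
    (hA : IsOpen A) (hx : x ∈ closure A) (hf : ContDiffAt ℝ ∞ f x) (hh : ContDiffAt ℝ ∞ h x)
    (he : EqOn f h A) : f x = h x ∧ fderiv ℝ f x = fderiv ℝ h x := by
  have : (nhdsWithin x A).NeBot := mem_closure_iff_nhdsWithin_neBot.1 hx
  have hd : ∀ y ∈ A, fderiv ℝ f y = fderiv ℝ h y := fun y hy =>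
    (Filter.eventuallyEq_of_mem (hA.mem_nhds hy) he).fderiv_eq
  constructor
  · refine tendsto_nhds_unique_of_eventuallyEq
      (hf.continuousAt.mono_left (nhdsWithin_le_nhds (s := A)))
      (hh.continuousAt.mono_left (nhdsWithin_le_nhds (s := A))) ?_
    exact Filter.eventuallyEq_of_mem self_mem_nhdsWithin he
  · have cf : ContinuousAt (fderiv ℝ f) x :=
      (hf.fderiv_right (m := 0) (by simp)).continuousAt
    have ch : ContinuousAt (fderiv ℝ h) x :=
      (hh.fderiv_right (m := 0) (by simp)).continuousAt
    refine tendsto_nhds_unique_of_eventuallyEq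
      (cf.mono_left (nhdsWithin_le_nhds (s := A)))
      (ch.mono_left (nhdsWithin_le_nhds (s := A))) ?_
    exact Filter.eventuallyEq_of_mem self_mem_nhdsWithin hd

namespace LUS

variable {l m n : ℕ}

/-- Group elements whose composites with a lift agree to first order are equal. -/
theorem IsLift.group_eq {L : LUS M m} {L' : LUS M n} {V : Set (E m)} {f : E m → E n}
    (H : IsLift L L' V f) {g g' : Equiv.Perm L'.dom} (hg : g ∈ L'.G) (hg' : g' ∈ L'.G) {x : E m}
    (hx : x ∈ V) (h0 : L'.act g (f x) = L'.act g' (f x))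
    (h1 : fderiv ℝ (L'.act g ∘ f) x = fderiv ℝ (L'.act g' ∘ f) x) : g = g' := by
  -- The element `g'⁻¹ * g` fixes `f x`. Since `f` has invertible derivative at `x`, the first-order
  -- agreement makes its derivative there the identity.
  have hγ : g'⁻¹ * g ∈ L'.G := mul_mem (inv_mem hg') hg
  have hfix : L'.act (g'⁻¹ * g) (f x) = f x := by rw [act_mul, h0, act_inv_act]
  have dd : ∀ {k : Equiv.Perm L'.dom}, k ∈ L'.G → ∀ {y}, y ∈ L'.dom →
      DifferentiableAt ℝ (L'.act k) y := fun hk _ hy =>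
    (contDiffAt_act hk hy).differentiableAt (by simp)
  have df : DifferentiableAt ℝ f x := (H.contDiffAt x hx).differentiableAt (by simp)
  have e1 : fderiv ℝ (L'.act (g'⁻¹ * g) ∘ f) x = fderiv ℝ f x := by
    have : L'.act (g'⁻¹ * g) ∘ f = L'.act g'⁻¹ ∘ (L'.act g ∘ f) := by
      ext1 y; simp [act_mul]
    rw [this, fderiv_comp x (dd (inv_mem hg') (act_mem g (H.mem_dom hx)))
      ((dd hg (H.mem_dom hx)).comp x df), h1]
    have e2 : f = L'.act g'⁻¹ ∘ (L'.act g' ∘ f) := by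
      ext1 y; simp [act_inv_act]
    conv_rhs => rw [e2]
    rw [fderiv_comp x (dd (inv_mem hg') (act_mem g' (H.mem_dom hx)))
      ((dd hg' (H.mem_dom hx)).comp x df)]
    simp only [Function.comp_apply, h0]
  rw [fderiv_comp x (dd hγ (H.mem_dom hx)) df] at e1
  obtain ⟨e, he⟩ := H.deriv x hx
  rw [he.fderiv] at e1
  have : g'⁻¹ * g = 1 := by
    refine eq_one_of_fderiv hγ (H.mem_dom hx) hfix ?_
    ext1 v
    have := DFunLike.congr_fun e1 (e.symm v)
    simpa using this
  exact (inv_mul_eq_one.1 this).symm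

/-- Two lifts on a connected open set differ by an element of the group. -/
theorem IsLift.exists_act_eq {L : LUS M m} {L' : LUS M n} {V : Set (E m)} {f h : E m → E n}
    (H : IsLift L L' V f) (H' : IsLift L L' V h) (hV : IsPreconnected V) :
    ∃ g ∈ L'.G, ∀ x ∈ V, h x = L'.act g (f x) := by
  have := L'.finite
  rcases V.eq_empty_or_nonempty with rfl | ⟨x₀, hx₀⟩
  · exact ⟨1, one_mem _, by simp⟩
  let C : L'.G → Set (E m) := fun g => {x | x ∈ V ∧ h x = L'.act g (f x)}
  let A : L'.G → Set (E m) := fun g => interior (C g)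
  have hC : ∀ g, ∀ x ∈ V, x ∈ closure (A g) → h x = L'.act g (f x) ∧
      fderiv ℝ h x = fderiv ℝ (L'.act g ∘ f) x := fun g x hx hxA =>
    eq_of_eqOn_of_mem_closure isOpen_interior hxA (H'.contDiffAt x hx)
      ((H.act_comp g.2).contDiffAt x hx) fun y hy => (interior_subset hy).2
  have huniq : ∀ g g', ∀ x ∈ V, x ∈ closure (A g) → x ∈ closure (A g') → g = g' := by
    intro g g' x hx hg hg'
    obtain ⟨a, b⟩ := hC g x hx hg
    obtain ⟨a', b'⟩ := hC g' x hx hg'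
    exact Subtype.ext (H.group_eq g.2 g'.2 hx (a.symm.trans a') (b.symm.trans b'))
  -- The sets `C g` are relatively closed and cover the Baire space `V`, so the union of their
  -- interiors is dense. As the group is finite, the closure of that union is the union of the
  -- closures.
  have hcov : ∀ x ∈ V, ∃ g, x ∈ closure (A g) := by
    intro x hx
    have : BaireSpace V := H.isOpen.baireSpace
    have hd : Dense (⋃ g : L'.G, interior ((↑) ⁻¹' C g : Set V)) := by
      refine dense_iUnion_interior_of_closed (fun g => ?_) ?_
      · have : ((↑) ⁻¹' C g : Set V) = {y : V | h y = (L'.act g ∘ f) y} := by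
          ext y; simp [C]
        rw [this]
        exact isClosed_eq (continuousOn_iff_continuous_domRestrict.1 H'.continuousOn)
          (continuousOn_iff_continuous_domRestrict.1 (H.act_comp g.2).continuousOn)
      · refine eq_univ_of_forall fun y => mem_iUnion.2 ?_
        obtain ⟨g, hg, hgy⟩ := LUS.exists_act_eq (H.mem_dom y.2)
          ((H'.proj_eq _ y.2).trans (H.proj_eq _ y.2).symm)
        exact ⟨⟨g, hg⟩, y.2, hgy.symm⟩
    have hi : ∀ g : L'.G, (↑) '' (interior ((↑) ⁻¹' C g : Set V)) ⊆ A g := by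
      intro g
      refine interior_maximal ?_ (H.isOpen.isOpenMap_subtype_val _ isOpen_interior)
      rintro _ ⟨y, hy, rfl⟩
      exact (interior_subset hy : y ∈ ((↑) ⁻¹' C g : Set V))
    have hxc : x ∈ closure (⋃ g, A g) := by
      have h1 := image_closure_subset_closure_image continuous_subtype_val
        (mem_image_of_mem (Subtype.val : V → E m) (hd ⟨x, hx⟩))
      refine closure_mono ?_ h1
      rw [image_iUnion]
      exact iUnion_mono hi
    rw [closure_iUnion_of_finite] at hxc
    exact mem_iUnion.1 hxc
  obtain ⟨g, hg⟩ := hcov x₀ hx₀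
  -- By `huniq` the closures of the sets `A g` are disjoint within `V`. Near a point of one closure
  -- all the others are absent, so `A g` is relatively closed as well as open.
  have hclosure : closure (A g) ∩ V ⊆ A g := by
    rintro x ⟨hxg, hx⟩
    have hW : V ∩ (⋃ g' ∈ {g' : L'.G | g' ≠ g}, closure (A g'))ᶜ ∈ nhds x := by
      refine Filter.inter_mem (H.isOpen.mem_nhds hx) (IsOpen.mem_nhds ?_ ?_)
      · exact ((Set.toFinite _).isClosed_biUnion fun _ _ => isClosed_closure).isOpen_compl
      · simp only [mem_compl_iff, mem_iUnion, not_exists]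
        exact fun g' hne hg' => hne (huniq _ _ x hx hg' hxg)
    refine mem_interior_iff_mem_nhds.2 (Filter.mem_of_superset hW ?_)
    rintro y ⟨hy, hy'⟩
    obtain ⟨g', hg'⟩ := hcov y hy
    have : g' = g := by
      by_contra hne
      exact hy' (mem_biUnion (show g' ∈ {g' : L'.G | g' ≠ g} from hne) hg')
    exact ⟨hy, (hC g y hy (this ▸ hg')).1⟩
  have hne : (V ∩ A g).Nonempty := ⟨x₀, hx₀, hclosure ⟨hg, hx₀⟩⟩
  have hVA : V ⊆ A g := hV.subset_of_closure_inter_subset isOpen_interior hne hclosure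
  exact ⟨g, g.2, fun x hx => (interior_subset (hVA hx)).2⟩

/-- Two lifts on a connected open set agree if they agree on a non-empty open subset. -/
theorem IsLift.eqOn {L : LUS M m} {L' : LUS M n} {V A : Set (E m)} {f h : E m → E n}
    (H : IsLift L L' V f) (H' : IsLift L L' V h) (hV : IsPreconnected V) (hA : IsOpen A)
    (hne : (A ∩ V).Nonempty) (he : EqOn f h A) : EqOn f h V := by
  obtain ⟨g, hg, hgf⟩ := H.exists_act_eq H' hV
  obtain ⟨x, hxA, hxV⟩ := hne
  have h1 : g = 1 := by
    have hev : ∀ᶠ y in nhds x, y ∈ A ∩ V := (hA.inter H.isOpen).mem_nhds ⟨hxA, hxV⟩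
    refine H.group_eq hg (one_mem _) hxV ?_ (Filter.EventuallyEq.fderiv_eq ?_)
    · rw [← hgf x hxV, act_one, he hxA]
    · filter_upwards [hev] with y hy
      simp only [Function.comp_apply]
      rw [← hgf y hy.2, act_one, he hy.1]
  intro x hx
  rw [hgf x hx, h1, act_one]

/-! ### Germ isomorphisms and injections -/

/-- The local uniformizing systems are isomorphic near `p`. -/
def GermIso (L : LUS M m) (L' : LUS M n) (p : M) : Prop :=
  ∃ V f x, IsLift L L' V f ∧ x ∈ V ∧ L.proj x = some p

/-- Each group is transitive on the points above `p`, so composing a lift with group elements on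
both sides adjusts its source and target points. -/
theorem GermIso.exists_lift {L : LUS M m} {L' : LUS M n} {p : M} (H : GermIso L L' p) {x : E m}
    {y : E n} (hx : L.proj x = some p) (hy : L'.proj y = some p) :
    ∃ V f, IsLift L L' V f ∧ x ∈ V ∧ f x = y := by
  obtain ⟨V, f, z, hf, hz, hzp⟩ := H
  obtain ⟨g, hg, rfl⟩ := LUS.exists_act_eq (mem_dom_of_proj hx) (hzp.trans hx.symm)
  have h1 := (isLift_act hg).comp hf
  have hx1 : x ∈ (L.dom : Set (E m)) ∩ L.act g ⁻¹' V := ⟨mem_dom_of_proj hx, hz⟩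
  obtain ⟨g', hg', rfl⟩ := LUS.exists_act_eq (h1.mem_dom hx1) (hy.trans
    (hx.symm.trans (h1.proj_eq x hx1).symm))
  exact ⟨_, _, h1.act_comp hg', hx1, rfl⟩

theorem GermIso.symm {L : LUS M m} {L' : LUS M n} {p : M} (H : GermIso L L' p) :
    GermIso L' L p := by
  obtain ⟨V, f, x, hf, hx, hp⟩ := H
  obtain ⟨e, hxe, -, hef, hl⟩ := hf.exists_localHomeo hx
  exact ⟨_, _, e x, hl, e.map_source hxe, by rw [hef, hf.proj_eq x hx, hp]⟩

theorem GermIso.trans {L : LUS M l} {L' : LUS M m} {L'' : LUS M n} {p : M} (H : GermIso L L' p)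
    (H' : GermIso L' L'' p) : GermIso L L'' p := by
  obtain ⟨V, f, x, hf, hx, hp⟩ := H
  have hp' := (hf.proj_eq x hx).trans hp
  obtain ⟨V', f', y, hf', hy, hyp⟩ := H'
  obtain ⟨V'', k, hk, hxk, -⟩ := GermIso.exists_lift ⟨V', f', y, hf', hy, hyp⟩ hp'
    ((hf'.proj_eq y hy).trans hyp)
  exact ⟨_, _, x, hf.comp hk, ⟨hx, hxk⟩, hp⟩

theorem IsLift.germIso {L : LUS M m} {L' : LUS M n} {f : E m → E n}
    (H : IsLift L L' L.dom f) {p : M} (hp : p ∈ range L.φ) : GermIso L L' p := by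
  obtain ⟨x, hx⟩ := mem_range.1 hp
  exact ⟨_, f, x, H, mem_dom_of_proj hx, hx⟩

theorem GermIso.mem_range_left {L : LUS M m} {L' : LUS M n} {p : M} (H : GermIso L L' p) :
    p ∈ range L.φ := by
  obtain ⟨V, f, x, hf, hx, hp⟩ := H
  exact mem_range.2 ⟨x, hp⟩

theorem GermIso.mem_range_right {L : LUS M m} {L' : LUS M n} {p : M} (H : GermIso L L' p) :
    p ∈ range L'.φ :=
  H.symm.mem_range_left

/-- Injections are injective lifts. -/
theorem injects_iff {L : LUS M m} {L' : LUS M n} :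
    L.Injects L' ↔ ∃ f, IsLift L L' L.dom f ∧ InjOn f L.dom := by
  constructor
  · rintro ⟨V, hV, j, hj⟩
    let f : E m → E n := Function.extend ((↑) : L.dom → E m) (fun y => (j y : E n)) 0
    let k : E n → E m := Function.extend ((↑) : V → E n) (fun y => (j.symm y : E m)) 0
    have hf : ∀ x : L.dom, f x = j x := fun x => Subtype.val_injective.extend_apply _ _ x
    have hk : ∀ x : V, k x = j.symm x := fun x => Subtype.val_injective.extend_apply _ _ x
    have hfs := (contMDiff_iff_contDiffAt hf).1 j.contMDiff
    have hks := (contMDiff_iff_contDiffAt hk).1 j.symm.contMDiff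
    have hfV : ∀ x ∈ L.dom, f x ∈ V := fun x hx => by rw [hf ⟨x, hx⟩]; exact (j _).2
    have hkf : ∀ x ∈ L.dom, k (f x) = x := fun x hx => by
      rw [hf ⟨x, hx⟩, hk, j.symm_apply_apply]
    have hfk : ∀ y ∈ V, f (k y) = y := fun y hy => by
      rw [hk ⟨y, hy⟩, hf, j.apply_symm_apply]
    refine ⟨f, ⟨L.dom.isOpen, subset_rfl, ?_, hfs, ?_⟩, ?_⟩
    · intro x hx
      rw [show L.proj x = _ from L.proj_coe ⟨x, hx⟩, hj]
      exact proj_eq_some.2 ⟨hV (hfV x hx), by congr 1; exact Subtype.ext (hf ⟨x, hx⟩)⟩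
    · intro x hx
      have h1 : HasFDerivAt f (fderiv ℝ f x) x :=
        ((hfs x hx).differentiableAt (by simp)).hasFDerivAt
      have h2 : HasFDerivAt k (fderiv ℝ k (f x)) (f x) :=
        ((hks _ (hfV x hx)).differentiableAt (by simp)).hasFDerivAt
      have h1' : HasFDerivAt f (fderiv ℝ f x) (k (f x)) := by rwa [hkf x hx]
      have i12 := ((h2.comp x h1).congr_of_eventuallyEq (f₁ := id)
        (Filter.eventuallyEq_of_mem (L.dom.isOpen.mem_nhds hx)
          fun y hy => (hkf y hy).symm)).unique (hasFDerivAt_id x)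
      have i21 := ((h1'.comp (f x) h2).congr_of_eventuallyEq (f₁ := id)
        (Filter.eventuallyEq_of_mem (V.isOpen.mem_nhds (hfV x hx))
          fun y hy => (hfk y hy).symm)).unique (hasFDerivAt_id _)
      refine ⟨ContinuousLinearEquiv.equivOfInverse (fderiv ℝ f x)
        (fderiv ℝ k (f x)) (fun v => ?_) (fun v => ?_), ?_⟩
      · exact DFunLike.congr_fun i12 v
      · exact DFunLike.congr_fun i21 v
      · convert! h1
    · intro x hx y hy hxy
      rw [← hkf x hx, hxy, hkf y hy]
  · rintro ⟨f, hf, hinj⟩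
    have hopen : IsOpen (f '' L.dom) := by
      rw [isOpen_iff_mem_nhds]
      rintro _ ⟨x, hx, rfl⟩
      obtain ⟨e, hxe, hes, hef, -⟩ := hf.exists_localHomeo hx
      refine Filter.mem_of_superset (e.open_target.mem_nhds (hef x ▸ e.map_source hxe)) ?_
      intro y hy
      exact ⟨e.symm y, hes (e.map_target hy), by rw [← hef, e.right_inv hy]⟩
    let V : Opens (E n) := ⟨f '' L.dom, hopen⟩
    have hV : V ≤ L'.dom := by
      rintro _ ⟨x, hx, rfl⟩; exact hf.mem_dom hx
    let j : L.dom ≃ V := Equiv.Set.imageOfInjOn f L.dom hinj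
    have hj : ∀ x : L.dom, f x = j x := fun x => rfl
    let k : E n → E m := Function.extend ((↑) : V → E n) (fun y => (j.symm y : E m)) 0
    have hk : ∀ x : V, k x = j.symm x := fun x => Subtype.val_injective.extend_apply _ _ x
    refine ⟨V, hV, ⟨j, (contMDiff_iff_contDiffAt hj).2 hf.contDiffAt,
      (contMDiff_iff_contDiffAt hk).2 ?_⟩, ?_⟩
    · rintro _ ⟨x, hx, rfl⟩
      obtain ⟨e, hxe, hes, hef, hl⟩ := hf.exists_localHomeo hx
      refine (hl.contDiffAt _ (hef x ▸ e.map_source hxe)).congr_of_eventuallyEq ?_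
      refine Filter.eventuallyEq_of_mem (e.open_target.mem_nhds (hef x ▸ e.map_source hxe)) ?_
      intro y hy
      have h1 : e.symm y ∈ L.dom := hes (e.map_target hy)
      have h2 : (j ⟨e.symm y, h1⟩ : E n) = y := by
        rw [← hj]; exact (hef _).symm.trans (e.right_inv hy)
      have h3 := hk (j ⟨e.symm y, h1⟩)
      rwa [h2, j.symm_apply_apply] at h3
    · intro x
      have h1 := hf.proj_eq x x.2
      rw [proj_coe, proj_eq_some] at h1
      obtain ⟨h2, h3⟩ := h1
      exact h3.symm

end LUS

/-! ### Extension of lifts over star-shaped domains -/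

namespace LUS

variable {l m n : ℕ}

theorem IsLift.eqOn_of_eventuallyEq {L : LUS M m} {L' : LUS M n} {V : Set (E m)} {f h : E m → E n}
    (H : IsLift L L' V f) (H' : IsLift L L' V h) (hV : IsPreconnected V) {x : E m} (hx : x ∈ V)
    (he : f =ᶠ[nhds x] h) : EqOn f h V := by
  obtain ⟨A, hA, hAo, hxA⟩ := eventually_nhds_iff.1 he
  exact H.eqOn H' hV hAo ⟨x, hxA, hx⟩ hA

open Classical in
/-- A lift on a convex set extends to the union with a second convex set on which a lift exists. -/
theorem IsLift.exists_extension {L : LUS M m} {L' : LUS M n} {V B : Set (E m)} {f h : E m → E n}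
    (H : IsLift L L' V f) (hV : Convex ℝ V) (H' : IsLift L L' B h) (hB : Convex ℝ B) :
    ∃ k, IsLift L L' (V ∪ B) k ∧ EqOn k f V := by
  -- The overlap is convex, hence connected, so a single group element corrects `h` to match `f`
  -- there.
  obtain ⟨g, hg, hgf⟩ := (H'.mono inter_subset_right (H.isOpen.inter H'.isOpen)).exists_act_eq
    (H.mono inter_subset_left (H.isOpen.inter H'.isOpen)) (hV.inter hB).isPreconnected
  have h2 := H'.act_comp hg
  let k : E m → E n := fun x => if x ∈ V then f x else L'.act g (h x)
  have kV : EqOn k f V := fun x hx => if_pos hx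
  have kB : EqOn k (L'.act g ∘ h) B := fun x hx => by
    by_cases hxV : x ∈ V
    · rw [kV hxV]; exact hgf x ⟨hxV, hx⟩
    · exact if_neg hxV
  refine ⟨k, IsLift.of_local (H.isOpen.union H'.isOpen) ?_, kV⟩
  rintro x (hx | hx)
  · exact ⟨V, f, H, hx, Filter.eventuallyEq_of_mem (H.isOpen.mem_nhds hx) kV⟩
  · exact ⟨B, _, h2, hx, Filter.eventuallyEq_of_mem (H'.isOpen.mem_nhds hx) kB⟩

/-- A germ of a lift at `x₀` extends along segments. -/
theorem exists_lift_along_segment {L : LUS M m} {L' : LUS M n} {x₀ x : E m}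
    (hloc : ∀ y ∈ L.dom, ∃ V f, IsLift L L' V f ∧ y ∈ V) (hx : segment ℝ x₀ x ⊆ L.dom)
    {V₀ : Set (E m)} {f₀ : E m → E n} (H₀ : IsLift L L' V₀ f₀) (hx₀ : x₀ ∈ V₀) :
    ∃ V f, IsLift L L' V f ∧ Convex ℝ V ∧ segment ℝ x₀ x ⊆ V ∧ f =ᶠ[nhds x₀] f₀ := by
  let c : ℝ → E m := AffineMap.lineMap x₀ x
  have hc : Continuous c := AffineMap.lineMap_continuous
  let Q : ℝ → Prop := fun t =>
    ∃ V f, IsLift L L' V f ∧ Convex ℝ V ∧ segment ℝ x₀ (c t) ⊆ V ∧ f =ᶠ[nhds x₀] f₀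
  have hseg : ∀ t ∈ Icc (0 : ℝ) 1, segment ℝ x₀ (c t) = c '' Icc 0 t := by
    intro t ht
    rw [segment_eq_image_lineMap]
    ext y
    constructor
    · rintro ⟨a, ha, rfl⟩
      refine ⟨a * t, ⟨mul_nonneg ha.1 ht.1, mul_le_of_le_one_left ht.1 ha.2⟩, ?_⟩
      simp only [c, AffineMap.lineMap_apply, vsub_eq_sub, vadd_eq_add, add_sub_cancel_right,
        smul_smul]
    · rintro ⟨a, ha, rfl⟩
      rcases ht.1.eq_or_lt with h | h
      · have : a = 0 := le_antisymm (ha.2.trans h.symm.le) ha.1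
        exact ⟨0, by simp, by simp [c, this]⟩
      · refine ⟨a / t, ⟨div_nonneg ha.1 ht.1, (div_le_one h).2 ha.2⟩, ?_⟩
        simp only [c, AffineMap.lineMap_apply, vsub_eq_sub, vadd_eq_add, add_sub_cancel_right,
          smul_smul, div_mul_cancel₀ a h.ne']
  have hcd : ∀ t ∈ Icc (0 : ℝ) 1, c t ∈ L.dom := fun t ht => hx (by
    rw [segment_eq_image_lineMap]; exact mem_image_of_mem _ ht)
  have hmono : ∀ s ∈ Icc (0 : ℝ) 1, ∀ t ∈ Icc (0 : ℝ) 1, s ≤ t → Q t → Q s := by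
    rintro s hs t ht hst ⟨V, f, h1, h2, h3, h4⟩
    refine ⟨V, f, h1, h2, ?_, h4⟩
    rw [hseg s hs]
    rw [hseg t ht] at h3
    exact (image_mono (Icc_subset_Icc_right hst)).trans h3
  have hstep : ∀ B h, IsLift L L' B h → Convex ℝ B → ∀ s ∈ Icc (0 : ℝ) 1, ∀ t ∈ Icc (0 : ℝ) 1,
      c s ∈ B → c t ∈ B → Q s → Q t := by
    intro B h hh hB s hs t ht hsB htB hQ
    rcases le_total t s with hts | hst
    · exact hmono t ht s hs hts hQ
    obtain ⟨V, f, h1, h2, h3, h4⟩ := hQ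
    obtain ⟨k, hk, hkf⟩ := h1.exists_extension h2 hh hB
    have hsub : segment ℝ x₀ (c t) ⊆ V ∪ B := by
      rw [hseg s hs] at h3
      rw [hseg t ht]
      rintro _ ⟨a, ha, rfl⟩
      rcases le_total a s with h | h
      · exact Or.inl (h3 ⟨a, ⟨ha.1, h⟩, rfl⟩)
      · refine Or.inr ((hB.affine_preimage (AffineMap.lineMap x₀ x : ℝ →ᵃ[ℝ] E m)).ordConnected.out
          hsB htB ⟨h, ha.2⟩)
    -- The union `V ∪ B` need not be convex; a thin neighbourhood of the compact segment is, and it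
    -- lies in the union.
    have hcomp : IsCompact (segment ℝ x₀ (c t)) := by
      rw [hseg t ht]; exact isCompact_Icc.image hc
    obtain ⟨δ, hδ, hδs⟩ := hcomp.exists_thickening_subset_open hk.isOpen hsub
    refine ⟨_, k, hk.mono hδs Metric.isOpen_thickening, (convex_segment _ _).thickening δ,
      Metric.self_subset_thickening hδ _, Filter.EventuallyEq.trans ?_ h4⟩
    exact Filter.eventuallyEq_of_mem (h1.isOpen.mem_nhds (h3 (left_mem_segment ℝ _ _))) hkf
  have hball : ∀ y ∈ L.dom, ∃ B h, IsLift L L' B h ∧ Convex ℝ B ∧ y ∈ B := by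
    intro y hy
    obtain ⟨V, f, hf, hyV⟩ := hloc y hy
    obtain ⟨r, hr, hrV⟩ := Metric.isOpen_iff.1 hf.isOpen y hyV
    exact ⟨_, f, hf.mono hrV Metric.isOpen_ball, convex_ball y r, Metric.mem_ball_self hr⟩
  have h0 : Q 0 := by
    obtain ⟨r, hr, hrV⟩ := Metric.isOpen_iff.1 H₀.isOpen x₀ hx₀
    refine ⟨_, f₀, H₀.mono hrV Metric.isOpen_ball, convex_ball x₀ r, ?_, Filter.EventuallyEq.rfl⟩
    simp [c, hr]
  have h1 : Q 0 → Q 1 := by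
    refine isPreconnected_Icc.induction₂' (fun s t => Q s → Q t) (s := Icc (0 : ℝ) 1) ?_ ?_
      (left_mem_Icc.2 zero_le_one) (right_mem_Icc.2 zero_le_one)
    · intro t ht
      obtain ⟨B, h, hh, hB, htB⟩ := hball _ (hcd t ht)
      have : c ⁻¹' B ∈ nhdsWithin t (Icc 0 1) :=
        mem_nhdsWithin_of_mem_nhds (hc.continuousAt.preimage_mem_nhds (hh.isOpen.mem_nhds htB))
      filter_upwards [this, self_mem_nhdsWithin] with s hs hs'
      exact ⟨hstep B h hh hB t ht s hs' htB hs, hstep B h hh hB s hs' t ht hs htB⟩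
    · intro a b d _ _ _ hab hbd ha
      exact hbd (hab ha)
  have h2 := h1 h0
  simpa [Q, c] using h2

/-- Local lifts on a star-shaped domain can be glued to a global one. -/
theorem exists_lift_of_starConvex {L : LUS M m} {L' : LUS M n} {x₀ : E m} (hx₀ : x₀ ∈ L.dom)
    (hs : StarConvex ℝ x₀ (L.dom : Set (E m)))
    (hloc : ∀ y ∈ L.dom, ∃ V f, IsLift L L' V f ∧ y ∈ V) : ∃ f, IsLift L L' L.dom f := by
  obtain ⟨V₀, f₀, H₀, hx₀V⟩ := hloc x₀ hx₀
  have key : ∀ x : E m, ∃ V f, x ∈ L.dom →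
      IsLift L L' V f ∧ Convex ℝ V ∧ segment ℝ x₀ x ⊆ V ∧ f =ᶠ[nhds x₀] f₀ := by
    intro x
    by_cases hx : x ∈ L.dom
    · obtain ⟨V, f, h⟩ := exists_lift_along_segment hloc (hs.segment_subset hx) H₀ hx₀V
      exact ⟨V, f, fun _ => h⟩
    · exact ⟨∅, f₀, fun h => (hx h).elim⟩
  choose V f hVf using key
  -- The lifts along different segments have the same germ at `x₀`, so they agree on the convex
  -- intersection of their domains.
  refine ⟨fun x => f x x, IsLift.of_local L.dom.isOpen fun x hx => ?_⟩
  obtain ⟨h1, h2, h3, h4⟩ := hVf x hx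
  have hxV : x ∈ V x := h3 (right_mem_segment ℝ _ _)
  refine ⟨V x, f x, h1, hxV, ?_⟩
  filter_upwards [h1.isOpen.mem_nhds hxV] with y hy
  obtain ⟨k1, k2, k3, k4⟩ := hVf y (h1.subset hy)
  have ho := h1.isOpen.inter k1.isOpen
  exact (k1.mono inter_subset_right ho).eqOn_of_eventuallyEq (h1.mono inter_subset_left ho)
    (h2.inter k2).isPreconnected
    ⟨h3 (left_mem_segment ℝ _ _), k3 (left_mem_segment ℝ _ _)⟩ (k4.trans h4.symm)
    ⟨hy, k3 (right_mem_segment ℝ _ _)⟩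

/-! ### Good charts inject -/

/-- The domain is star-shaped about a common fixed point of the group. -/
def Good (L : LUS M n) : Prop :=
  ∃ x₀ ∈ L.dom, (∀ g ∈ L.G, L.act g x₀ = x₀) ∧ StarConvex ℝ x₀ (L.dom : Set (E n))

theorem isPreconnected_dom (L : LUS M n) : IsPreconnected (L.dom : Set (E n)) :=
  L.connected.isPreconnected

/-- A global lift is injective if the group has a fixed point. -/
theorem IsLift.injOn {L : LUS M m} {L' : LUS M n} {f : E m → E n} (H : IsLift L L' L.dom f)
    {x₀ : E m} (hx₀ : x₀ ∈ L.dom) (hfix : ∀ g ∈ L.G, L.act g x₀ = x₀) : InjOn f L.dom := by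
  intro x hx y hy hxy
  obtain ⟨g, hg, hgx⟩ := LUS.exists_act_eq hx
    (((H.proj_eq x hx).symm.trans (congrArg _ hxy)).trans (H.proj_eq y hy)).symm
  have Hg : IsLift L L' L.dom (f ∘ L.act g) :=
    (isLift_act hg).comp_of_mapsTo H fun z hz => act_mem g hz
  obtain ⟨g', hg', hgg'⟩ := H.exists_act_eq Hg L.isPreconnected_dom
  have hg'x : L'.act g' (f x) = f x := by
    rw [← hgg' x hx, Function.comp_apply, hgx, hxy]
  -- Conjugating `g'` by a local inverse of `f` gives a lift from `L` to itself near `x`. By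
  -- rigidity it is an element `k` fixing `x`.
  obtain ⟨e, hxe, hes, hef, hl⟩ := H.exists_localHomeo hx
  have h1 := (H.act_comp hg').comp hl
  have hx1 : x ∈ (L.dom : Set (E m)) ∩ (L'.act g' ∘ f) ⁻¹' e.target := by
    refine ⟨hx, ?_⟩
    rw [mem_preimage, Function.comp_apply, hg'x, ← hef]
    exact e.map_source hxe
  obtain ⟨r, hr, hrV⟩ := Metric.isOpen_iff.1 h1.isOpen x hx1
  have h2 := h1.mono hrV Metric.isOpen_ball
  obtain ⟨k, hk, hkx⟩ := (isLift_id h2.isOpen h2.subset fun _ _ => rfl).exists_act_eq h2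
    (convex_ball x r).isPreconnected
  have hxr : x ∈ Metric.ball x r := Metric.mem_ball_self hr
  have hkx' : L.act k x = x := by
    rw [← show _ = L.act k x from hkx x hxr]
    simp only [Function.comp_apply, hg'x]
    rw [← hef, e.left_inv hxe]
  have Hk : IsLift L L' L.dom (f ∘ L.act k) :=
    (isLift_act hk).comp_of_mapsTo H fun z hz => act_mem k hz
  -- Near `x` both maps equal `L'.act g' ∘ f`; rigidity spreads the equality over the connected
  -- domain.
  have hgk : EqOn (f ∘ L.act g) (f ∘ L.act k) L.dom := by
    refine Hg.eqOn Hk L.isPreconnected_dom Metric.isOpen_ball ⟨x, hxr, hx⟩ fun z hz => ?_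
    have hz1 := hrV hz
    have h5 : f (L.act k z) = L'.act g' (f z) := by
      rw [← show _ = L.act k z from hkx z hz, ← hef]; exact e.right_inv hz1.2
    rw [hgg' z hz1.1]; exact h5.symm
  have hγ : g * k⁻¹ ∈ L.G := mul_mem hg (inv_mem hk)
  have hγf : ∀ z ∈ L.dom, f (L.act (g * k⁻¹) z) = f z := by
    intro z hz
    rw [act_mul]
    exact (hgk (act_mem k⁻¹ hz)).trans (congrArg f (L.act_act_inv k z))
  have hγx₀ := hfix _ hγ
  -- This element fixes `x₀` and preserves `f`, which is injective near `x₀`; so it is the identity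
  -- near `x₀`. Thus `g = k`, and `k` fixes `x`.
  have h1 : g * k⁻¹ = 1 := by
    refine eq_one_of_fderiv hγ hx₀ hγx₀ ?_
    obtain ⟨e, hxe, hes, hef, -⟩ := H.exists_localHomeo hx₀
    have hnh : L.act (g * k⁻¹) ⁻¹' e.source ∈ nhds x₀ := by
      refine (contDiffAt_act hγ hx₀).continuousAt.preimage_mem_nhds ?_
      rw [hγx₀]; exact e.open_source.mem_nhds hxe
    have hev : L.act (g * k⁻¹) =ᶠ[nhds x₀] id := by
      filter_upwards [hnh, e.open_source.mem_nhds hxe] with z hz hz'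
      refine e.injOn hz hz' ?_
      rw [hef, hef]; exact hγf z (hes hz')
    rw [hev.fderiv_eq, fderiv_id]
  rw [← hgx, mul_inv_eq_one.1 h1, hkx']

/-- A good local uniformizing system injects wherever it does so locally. -/
theorem Good.injects {L : LUS M m} {L' : LUS M n} (hL : L.Good)
    (h : ∀ p ∈ range L.φ, GermIso L L' p) : L.Injects L' := by
  obtain ⟨x₀, hx₀, hfix, hs⟩ := hL
  obtain ⟨f, hf⟩ := exists_lift_of_starConvex (L' := L') hx₀ hs fun y hy => by
    have hg := h _ (mem_range_self (⟨y, hy⟩ : L.dom))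
    obtain ⟨z, hz⟩ := mem_range.1 hg.mem_range_right
    obtain ⟨V, f, hf, hyV, -⟩ := hg.exists_lift (L.proj_coe ⟨y, hy⟩) hz
    exact ⟨V, f, hf, hyV⟩
  exact injects_iff.2 ⟨f, hf, hf.injOn hx₀ hfix⟩

end LUS

/-! ### Small good charts -/

theorem eventually_forall_mem_ball {X : Type*} [PseudoMetricSpace X] {x : X} {P : X → Prop}
    (h : ∀ᶠ y in nhds x, P y) :
    ∀ᶠ r in nhdsWithin (0 : ℝ) (Ioi 0), ∀ y ∈ Metric.ball x r, P y := by
  obtain ⟨δ, hδ, H⟩ := Metric.eventually_nhds_iff_ball.1 h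
  filter_upwards [Ioo_mem_nhdsGT hδ] with r hr y hy
  exact H y (Metric.ball_subset_ball hr.2.le hy)

/-- The sublevel sets of `‖f · - f x‖` are star-shaped near a point `x` where `f` is a local
diffeomorphism. -/
theorem eventually_norm_sub_le {m n : ℕ} {f : E m → E n} {e : E m ≃L[ℝ] E n} {x : E m}
    (hf : HasStrictFDerivAt f (e : E m →L[ℝ] E n) x) :
    ∀ᶠ r in nhdsWithin (0 : ℝ) (Ioi 0), ∀ y ∈ Metric.ball x r, ∀ t ∈ Icc (0 : ℝ) 1,
      ‖f (x + t • (y - x)) - f x‖ ≤ ‖f y - f x‖ := by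
  set K : ℝ := ‖(e.symm : E n →L[ℝ] E m)‖
  have hK : 0 ≤ K := norm_nonneg _
  have hKe : ∀ v, ‖v‖ ≤ K * ‖e v‖ := fun v => by
    simpa using (e.symm : E n →L[ℝ] E m).le_opNorm (e v)
  -- With this choice the first-order error is at most a quarter of the linear term. The summand `1`
  -- covers `K = 0`, which occurs in dimension zero.
  set ε : ℝ := 1 / (4 * (K + 1))
  have hε : 0 < ε := by positivity
  have hεe : ∀ v, ε * ‖v‖ ≤ ‖e v‖ / 4 := fun v => by
    have : ε * (K + 1) = 1 / 4 := by simp only [ε]; field_simp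
    nlinarith [hKe v, norm_nonneg (e v), norm_nonneg v]
  have hsm := hasStrictFDerivAt_iff_isLittleO.1 hf |>.bound hε
  rw [nhds_prod_eq, Filter.eventually_prod_self_iff'] at hsm
  obtain ⟨U, hU, hUs⟩ := hsm
  filter_upwards [eventually_forall_mem_ball (P := (· ∈ U)) hU, self_mem_nhdsWithin]
    with r hr hr0 y hy t ht
  have hx : x ∈ Metric.ball x r := Metric.mem_ball_self hr0
  have hz : x + t • (y - x) ∈ Metric.ball x r := by
    have := (convex_ball x r).starConvex hx hy (sub_nonneg.2 ht.2) ht.1 (by ring)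
    convert! this using 1
    module
  have e1 := hUs _ (hr _ hy) _ (hr _ hz)
  have e2 := hUs _ (hr _ hz) _ (hr _ hx)
  simp only at e1 e2
  set v := y - x with hv
  set z := x + t • v with hzdef
  have hyz : y - z = (1 - t) • v := by rw [hzdef, hv]; module
  have hzx : z - x = t • v := by rw [hzdef]; module
  rw [hyz] at e1
  rw [hzx] at e2
  have ht1 : 0 ≤ 1 - t := sub_nonneg.2 ht.2
  rw [norm_smul, Real.norm_of_nonneg ht1] at e1
  rw [norm_smul, Real.norm_of_nonneg ht.1] at e2
  simp only [map_smul, ContinuousLinearEquiv.coe_coe] at e1 e2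
  set u := e v
  set p := f y - f z - (1 - t) • u with hp
  set q := f z - f x - t • u with hq
  have hεv := hεe v
  have hp' : ‖p‖ ≤ (1 - t) * (‖u‖ / 4) := by
    refine e1.trans ?_
    nlinarith [mul_le_mul_of_nonneg_left hεv ht1]
  have hq' : ‖q‖ ≤ t * (‖u‖ / 4) := by
    refine e2.trans ?_
    nlinarith [mul_le_mul_of_nonneg_left hεv ht.1]
  have ha : f y - f z = (1 - t) • u + p := by rw [hp]; abel
  have hb : f z - f x = t • u + q := by rw [hq]; abel
  -- The two increments are close to `(1 - t) • u` and `t • u`, so their inner product is at least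
  -- `(1 - 1/4 - 1/4 - 1/16) * t * (1 - t) * ‖u‖ ^ 2`. Expanding the square of the norm of their sum
  -- then gives the claim.
  have hin : 0 ≤ inner ℝ (f y - f z) (f z - f x) := by
    rw [ha, hb, inner_add_left, inner_add_right, inner_add_right, inner_smul_left,
      inner_smul_left, inner_smul_right, inner_smul_right, real_inner_self_eq_norm_sq]
    simp only [conj_trivial]
    have i1 := (abs_le.1 (abs_real_inner_le_norm u q)).1
    have i2 := (abs_le.1 (abs_real_inner_le_norm p u)).1
    have i3 := (abs_le.1 (abs_real_inner_le_norm p q)).1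
    have j1 : ‖u‖ * ‖q‖ ≤ ‖u‖ * (t * (‖u‖ / 4)) := mul_le_mul_of_nonneg_left hq' (norm_nonneg _)
    have j2 : ‖p‖ * ‖u‖ ≤ (1 - t) * (‖u‖ / 4) * ‖u‖ :=
      mul_le_mul_of_nonneg_right hp' (norm_nonneg _)
    have j3 : ‖p‖ * ‖q‖ ≤ (1 - t) * (‖u‖ / 4) * (t * (‖u‖ / 4)) :=
      mul_le_mul hp' hq' (norm_nonneg _) (by positivity)
    have k1 : -((1 - t) * (‖u‖ * (t * (‖u‖ / 4)))) ≤ (1 - t) * inner ℝ u q := by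
      rw [← mul_neg]; exact mul_le_mul_of_nonneg_left (by linarith) ht1
    have k2 : -(t * ((1 - t) * (‖u‖ / 4) * ‖u‖)) ≤ t * inner ℝ p u := by
      rw [← mul_neg]; exact mul_le_mul_of_nonneg_left (by linarith) ht.1
    have k3 : 0 ≤ (1 - t) * t * ‖u‖ ^ 2 := by have := ht.1; positivity
    nlinarith
  have hsum : f y - f x = (f y - f z) + (f z - f x) := by abel
  refine le_of_sq_le_sq ?_ (norm_nonneg _)
  rw [hsum, norm_add_sq_real]
  nlinarith [sq_nonneg ‖f y - f z‖]

namespace LUS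

variable {n : ℕ}

/-- `L'` is the restriction of `L` to a connected open set that each element of the group either
preserves or moves off itself. -/
structure IsSub (L' L : LUS M n) : Prop where
  le : L'.dom ≤ L.dom
  proj_eq : ∀ x ∈ L'.dom, L.proj x = L'.proj x
  mapsTo : ∀ g ∈ L.G, ∀ x ∈ L'.dom, L.act g x ∈ L'.dom → ∀ y ∈ L'.dom, L.act g y ∈ L'.dom

/-- The restriction of a local uniformizing system to a suitable connected open set. -/
noncomputable def sub (L : LUS M n) (W : Opens (E n)) (hW : W ≤ L.dom)
    (hc : IsConnected (W : Set (E n)))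
    (hinv : ∀ g ∈ L.G, ∀ x ∈ W, L.act g x ∈ W → ∀ y ∈ W, L.act g y ∈ W) : LUS M n where
  dom := W
  connected := hc
  G :=
    { carrier := {h | ∃ g ∈ L.G, ∀ y : W, (h y : E n) = L.act g y}
      mul_mem' := by
        rintro a b ⟨g, hg, ha⟩ ⟨k, hk, hb⟩
        exact ⟨g * k, mul_mem hg hk, fun y => by rw [act_mul, ← hb, ← ha]; rfl⟩
      one_mem' := ⟨1, one_mem _, fun y => by rw [act_one]; rfl⟩
      inv_mem' := by
        rintro a ⟨g, hg, ha⟩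
        refine ⟨g⁻¹, inv_mem hg, fun y => ?_⟩
        rw [← L.act_inv_act g (a⁻¹ y : W), ← ha, show a (a⁻¹ y) = y from a.apply_symm_apply y] }
  finite := by
    have := L.finite
    -- Choosing an extension in `L.G` of each restricted element embeds the new group in a finite
    -- one; `1` is a dummy value for other permutations.
    have key : ∀ a : Equiv.Perm W, ∃ g : L.G, (∃ g ∈ L.G, ∀ y : W, (a y : E n) = L.act g y) →
        ∀ y : W, (a y : E n) = L.act g y := fun a => by
      by_cases h : ∃ g ∈ L.G, ∀ y : W, (a y : E n) = L.act g y
      · obtain ⟨g, hg, h⟩ := h; exact ⟨⟨g, hg⟩, fun _ => h⟩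
      · exact ⟨1, fun h' => (h h').elim⟩
    choose c hc using key
    refine Finite.of_injective (β := L.G) (fun a => c a.1) fun a b hab => ?_
    refine Subtype.ext (Equiv.ext fun y => Subtype.ext ?_)
    rw [hc a.1 a.2, hc b.1 b.2, show c a.1 = c b.1 from hab]
  smooth := by
    rintro a ⟨g, hg, ha⟩
    exact (contMDiff_iff_contDiffAt fun y => (ha y).symm).2 fun y hy => contDiffAt_act hg (hW hy)
  codim := by
    rintro a ⟨g, hg, ha⟩ h1 x hx
    have hg1 : g ≠ 1 := by
      rintro rfl
      exact h1 (Equiv.ext fun y => Subtype.ext (by rw [ha, act_one]; rfl))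
    have hgx : L.act g x = x := by rw [← ha, hx]
    have hd : differential a x = differential g ⟨x, hW x.2⟩ := by
      refine Filter.EventuallyEq.fderiv_eq ?_
      filter_upwards [W.isOpen.mem_nhds x.2] with y hy
      exact (Subtype.val_injective.extend_apply _ _ (⟨y, hy⟩ : W)).trans (ha _)
    rw [hd]
    exact L.codim g hg hg1 _ (Subtype.ext (by rw [← act_coe, hgx]))
  φ := L.φ ∘ Opens.inclusion hW
  continuous_φ := L.continuous_φ.comp (Opens.isOpenEmbedding_of_le hW).continuous
  isOpenMap_φ := L.isOpenMap_φ.comp (Opens.isOpenEmbedding_of_le hW).isOpenMap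
  fibres := by
    intro x y
    constructor
    · intro h
      obtain ⟨g, hg, hgx⟩ := (L.fibres _ _).1 h
      have hgx' : L.act g x = y := by
        rw [act_of_mem g (hW x.2)]; exact congrArg Subtype.val hgx
      have h1 := hinv g hg x x.2 (hgx' ▸ y.2)
      have h2 := hinv g⁻¹ (inv_mem hg) y y.2 (by rw [← hgx', act_inv_act]; exact x.2)
      exact ⟨⟨fun z => ⟨L.act g z, h1 z z.2⟩, fun z => ⟨L.act g⁻¹ z, h2 z z.2⟩,
        fun z => Subtype.ext (L.act_inv_act g z), fun z => Subtype.ext (L.act_act_inv g z)⟩,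
        ⟨g, hg, fun z => rfl⟩, Subtype.ext hgx'⟩
    · rintro ⟨a, ⟨g, hg, ha⟩, rfl⟩
      refine (L.fibres _ _).2 ⟨g, hg, Subtype.ext ?_⟩
      rw [← act_coe]; exact (ha x).symm

/-- Each point has arbitrarily small good restrictions of a local uniformizing system. -/
theorem exists_good_sub (L : LUS M n) {p : M} (hp : p ∈ range L.φ) {O : Set M} (hO : IsOpen O)
    (hpO : p ∈ O) : ∃ L' : LUS M n, L'.Good ∧ L'.IsSub L ∧ p ∈ range L'.φ ∧ range L'.φ ⊆ O := by
  have := L.finite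
  obtain ⟨⟨x, hx⟩, rfl⟩ := hp
  have ev1 : ∀ᶠ y in nhds x, ∃ h : y ∈ L.dom, L.φ ⟨y, h⟩ ∈ O := by
    have := (L.dom.isOpen.isOpenMap_subtype_val _ (hO.preimage L.continuous_φ)).mem_nhds
      (mem_image_of_mem Subtype.val (show (⟨x, hx⟩ : L.dom) ∈ L.φ ⁻¹' O from hpO))
    filter_upwards [this]
    rintro _ ⟨y, hy, rfl⟩
    exact ⟨y.2, hy⟩
  have ev2 : ∀ g : L.G, L.act g x ≠ x → ∀ᶠ r in nhdsWithin (0 : ℝ) (Ioi 0),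
      ∀ y ∈ Metric.ball x r, L.act g y ∉ Metric.ball x r := by
    intro g hg
    obtain ⟨U, U', hU, hU', hxU, hgU', hd⟩ := t2_separation hg.symm
    have h1 : ∀ᶠ y in nhds x, y ∈ U ∧ L.act g y ∈ U' := Filter.Eventually.and
      (hU.mem_nhds hxU)
      ((contDiffAt_act g.2 hx).continuousAt.preimage_mem_nhds (hU'.mem_nhds hgU'))
    filter_upwards [eventually_forall_mem_ball h1] with r hr y hy hgy
    exact disjoint_left.1 hd (hr _ hgy).1 (hr y hy).2
  have ev2' : ∀ᶠ r in nhdsWithin (0 : ℝ) (Ioi 0), ∀ g : L.G, L.act g x ≠ x →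
      ∀ y ∈ Metric.ball x r, L.act g y ∉ Metric.ball x r := by
    refine Filter.eventually_all.2 fun g => ?_
    by_cases hg : L.act g x ≠ x
    · filter_upwards [ev2 g hg] with r hr _ using hr
    · exact Filter.Eventually.of_forall fun r h => (hg h).elim
  have ev3 : ∀ᶠ r in nhdsWithin (0 : ℝ) (Ioi 0), ∀ g : L.G, ∀ y ∈ Metric.ball x r,
      ∀ t ∈ Icc (0 : ℝ) 1, ‖L.act g (x + t • (y - x)) - L.act g x‖ ≤ ‖L.act g y - L.act g x‖ := by
    refine Filter.eventually_all.2 fun g => ?_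
    obtain ⟨e, he⟩ := (isLift_act g.2).deriv x hx
    exact eventually_norm_sub_le ((contDiffAt_act g.2 hx).hasStrictFDerivAt' he (by simp))
  obtain ⟨r, ⟨⟨h1, h2⟩, h3⟩, hr : 0 < r⟩ :=
    (((eventually_forall_mem_ball ev1).and ev2').and ev3 |>.and self_mem_nhdsWithin).exists
  -- Intersecting preimages of the ball over the stabilizer of `x` makes `W` invariant under it,
  -- while all other elements move the ball off itself. By `h3` each preimage is star-shaped within
  -- the ball, so the action need not be linearized.
  let W : Opens (E n) := ⟨⋂ g : {g : L.G // L.act g x = x},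
      (L.dom : Set (E n)) ∩ L.act g.1 ⁻¹' Metric.ball x r,
    isOpen_iInter_of_finite fun g =>
      (isLift_act g.1.2).continuousOn.isOpen_inter_preimage L.dom.isOpen Metric.isOpen_ball⟩
  have hW : ∀ y, y ∈ W ↔ y ∈ L.dom ∧ ∀ g ∈ L.G, L.act g x = x → L.act g y ∈ Metric.ball x r := by
    intro y
    refine mem_iInter.trans ⟨fun h => ⟨(h ⟨1, L.act_one x⟩).1, fun g hg hgx =>
      (h ⟨⟨g, hg⟩, hgx⟩).2⟩, fun h g => ⟨h.1, h.2 _ g.1.2 g.2⟩⟩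
  have hWball : ∀ y ∈ W, y ∈ Metric.ball x r := fun y hy => by
    have := ((hW y).1 hy).2 1 (one_mem _) (act_one _ _)
    rwa [act_one] at this
  have hxW : x ∈ W := (hW x).2 ⟨hx, fun g _ hg => by rw [hg]; exact Metric.mem_ball_self hr⟩
  have hstar : StarConvex ℝ x (W : Set (E n)) := by
    rw [starConvex_iff_forall_pos hxW]
    intro y hy a b ha hb hab
    have hz : a • x + b • y = x + b • (y - x) := by
      rw [← eq_sub_iff_add_eq] at hab; rw [hab]; module
    have hzb : a • x + b • y ∈ Metric.ball x r :=
      (convex_ball x r).starConvex (Metric.mem_ball_self hr) (hWball y hy) ha.le hb.le hab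
    refine (hW _).2 ⟨(h1 _ hzb).1, fun g hg hgx => ?_⟩
    have := h3 ⟨g, hg⟩ y (hWball y hy) b ⟨hb.le, by linarith⟩
    simp only [← hz, hgx] at this
    rw [mem_ball_iff_norm]
    exact this.trans_lt (mem_ball_iff_norm.1 (((hW y).1 hy).2 g hg hgx))
  have hinv : ∀ g ∈ L.G, ∀ y ∈ W, L.act g y ∈ W → ∀ z ∈ W, L.act g z ∈ W := by
    intro g hg y hy hgy z hz
    have hgx : L.act g x = x := by
      by_contra hne
      exact h2 ⟨g, hg⟩ hne y (hWball y hy) (hWball _ hgy)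
    refine (hW _).2 ⟨act_mem g ((hW z).1 hz).1, fun k hk hkx => ?_⟩
    rw [← act_mul]
    exact ((hW z).1 hz).2 (k * g) (mul_mem hk hg) (by rw [act_mul, hgx, hkx])
  have hconn : IsConnected (W : Set (E n)) := by
    refine ⟨⟨x, hxW⟩, ?_⟩
    exact (hstar.isPathConnected hxW).isConnected.isPreconnected
  have hWd : W ≤ L.dom := fun y hy => ((hW y).1 hy).1
  refine ⟨L.sub W hWd hconn hinv, ⟨x, hxW, ?_, hstar⟩, ⟨hWd, ?_, hinv⟩,
    mem_range_self (f := (L.sub W hWd hconn hinv).φ) ⟨x, hxW⟩, ?_⟩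
  · rintro a ⟨g, hg, ha⟩
    have hax : (a ⟨x, hxW⟩ : E n) = L.act g x := ha _
    rw [act_of_mem a hxW, hax]
    by_contra hne
    exact h2 ⟨g, hg⟩ hne x (hWball x hxW) (hax ▸ hWball _ (a ⟨x, hxW⟩).2)
  · intro y hy
    rw [show L.proj y = _ from L.proj_coe ⟨y, hWd hy⟩]
    exact ((L.sub W hWd hconn hinv).proj_coe ⟨y, hy⟩).symm
  · rintro _ ⟨y, rfl⟩
    exact (h1 _ (hWball y y.2)).2

/-! ### Lifts and injections for restricted charts -/

theorem IsSub.isLift {L' L : LUS M n} (h : L'.IsSub L) : IsLift L' L L'.dom id :=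
  isLift_id L'.dom.isOpen subset_rfl h.proj_eq

theorem IsComponent.isLift {L' L : LUS M n} {Y : Opens M} (h : L'.IsComponent L Y) :
    IsLift L' L L'.dom id := by
  refine isLift_id L'.dom.isOpen subset_rfl fun x hx => ?_
  rw [show L'.proj x = _ from L'.proj_coe ⟨x, hx⟩, h.map]
  exact L.proj_coe ⟨x, h.le hx⟩

theorem isComponent_self {L : LUS M n} {Y : Opens M} (h : range L.φ ⊆ Y) : L.IsComponent L Y := by
  refine ⟨le_rfl, ?_, fun k => ?_, fun x => rfl⟩
  · have h1 : L.φ ⁻¹' (Y : Set M) = univ := by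
      ext x; simpa using h (mem_range_self x)
    obtain ⟨x, hx⟩ := L.connected.nonempty
    have h2 : range (Subtype.val : L.dom → E n) = L.dom := Subtype.range_coe
    rw [h1, image_univ, h2]
    exact ⟨x, hx, (L.isPreconnected_dom.connectedComponentIn hx).symm⟩
  · constructor
    · exact fun hk => ⟨k, hk, fun x => rfl⟩
    · rintro ⟨g, hg, h⟩
      have : k = g := Equiv.ext fun x => h x
      rwa [this]

/-- An injection whose image in `M` lies in that of a restriction lifts to the restriction. -/
theorem IsSub.injects {m : ℕ} {L₁ : LUS M m} {L' L : LUS M n} (h : L'.IsSub L)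
    (hi : L₁.Injects L) (hr : range L₁.φ ⊆ range L'.φ) : L₁.Injects L' := by
  obtain ⟨f, hf, hinj⟩ := injects_iff.1 hi
  have key : ∀ x ∈ L₁.dom, ∃ g ∈ L.G, L.act g (f x) ∈ L'.dom := by
    intro x hx
    obtain ⟨z, hz⟩ := mem_range.1 (hr (mem_range_self (⟨x, hx⟩ : L₁.dom)))
    have hzd := mem_dom_of_proj hz
    have := h.proj_eq z hzd
    obtain ⟨g, hg, hgz⟩ := LUS.exists_act_eq (hf.mem_dom hx)
      ((this.trans hz).trans ((L₁.proj_coe ⟨x, hx⟩).symm.trans (hf.proj_eq x hx).symm))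
    exact ⟨g, hg, hgz ▸ hzd⟩
  obtain ⟨x₀, hx₀⟩ := L₁.connected.nonempty
  obtain ⟨g, hg, hgx₀⟩ := key x₀ hx₀
  have hfg := hf.act_comp hg
  -- The element `g` chosen at `x₀` works everywhere. Near a limit point `x` of the good set,
  -- another element `k` also works; at a common point `g * k⁻¹` takes a point of `L'.dom` into
  -- `L'.dom`, hence preserves `L'.dom`.
  have hsub : (L₁.dom : Set (E m)) ⊆ L₁.dom ∩ (L.act g ∘ f) ⁻¹' L'.dom := by
    refine L₁.isPreconnected_dom.subset_of_closure_inter_subset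
      (hfg.continuousOn.isOpen_inter_preimage L₁.dom.isOpen L'.dom.isOpen)
      ⟨x₀, hx₀, hx₀, hgx₀⟩ ?_
    rintro x ⟨hxc, hx⟩
    refine ⟨hx, ?_⟩
    obtain ⟨k, hk, hkx⟩ := key x hx
    have ho := (hf.act_comp hk).continuousOn.isOpen_inter_preimage L₁.dom.isOpen L'.dom.isOpen
    obtain ⟨y, ⟨hy1, hy2⟩, hy3, hy4⟩ := mem_closure_iff.1 hxc _ ho ⟨hx, hkx⟩
    have h1 : L.act (g * k⁻¹) (L.act k (f y)) = L.act g (f y) := by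
      rw [act_mul, act_inv_act]
    have h2 := h.mapsTo (g * k⁻¹) (mul_mem hg (inv_mem hk)) _ hy2 (h1.symm ▸ hy4) _ hkx
    rwa [act_mul, act_inv_act] at h2
  refine injects_iff.2 ⟨L.act g ∘ f, ⟨hfg.isOpen, hfg.subset, fun x hx => ?_, hfg.contDiffAt,
    hfg.deriv⟩, fun x hx y hy hxy => hinj hx hy (L.act_injective g hxy)⟩
  rw [← hfg.proj_eq x hx]
  exact (h.proj_eq _ (hsub hx).2).symm

end LUS

/-! ### Compatibility of sets of charts -/

theorem LUS.IsSub.range_subset {n : ℕ} {L' L : LUS M n} (h : L'.IsSub L) :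
    range L'.φ ⊆ range L.φ :=
  fun _ hp => (h.isLift.germIso hp).mem_range_right

theorem Chart.isOpen_image (c : Chart M) : IsOpen c.image :=
  c.2.isOpenMap_φ.isOpen_range

/-- Any two members of `A` and `B` are locally isomorphic over all common points. -/
def Compat (A B : Set (Chart M)) : Prop :=
  ∀ c ∈ A, ∀ c' ∈ B, ∀ p ∈ c.image ∩ c'.image, c.2.GermIso c'.2 p

theorem Compat.symm {A B : Set (Chart M)} (h : Compat A B) : Compat B A :=
  fun c hc c' hc' p hp => (h c' hc' c hc p hp.symm).symm

/-- Germ isomorphisms compose only through a chart around the same point, which is why `B` has to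
cover the common points. -/
theorem Compat.trans {A B C : Set (Chart M)} (h : Compat A B) (h' : Compat B C)
    (hB : ∀ c ∈ A, ∀ c' ∈ C, ∀ p ∈ c.image ∩ c'.image, ∃ b ∈ B, p ∈ b.image) : Compat A C := by
  intro c hc c' hc' p hp
  obtain ⟨b, hb, hpb⟩ := hB c hc c' hc' p hp
  exact (h c hc b hb p ⟨hp.1, hpb⟩).trans (h' b hb c' hc' p ⟨hpb, hp.2⟩)

theorem Compat.mono {A A' B B' : Set (Chart M)} (h : Compat A B) (hA : A' ⊆ A) (hB : B' ⊆ B) :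
    Compat A' B' :=
  fun c hc c' hc' => h c (hA hc) c' (hB hc')

/-- Charts that lift globally to members of `A` inherit the compatibility of `A`. -/
theorem Compat.of_lift {A A' B : Set (Chart M)} (h : Compat A B)
    (hA : ∀ c ∈ A', ∃ a ∈ A, ∃ f, c.2.IsLift a.2 c.2.dom f) : Compat A' B := by
  intro c hc c' hc' p hp
  obtain ⟨a, ha, f, hf⟩ := hA c hc
  have h1 := hf.germIso hp.1
  exact h1.trans (h a ha c' hc' p ⟨h1.mem_range_right, hp.2⟩)

theorem Compat.of_isSub {A B : Set (Chart M)} (h : Compat A B) {c : Chart M} (hc : c ∈ A)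
    {L : LUS M c.1} (hL : L.IsSub c.2) : Compat {⟨c.1, L⟩} B := by
  refine h.of_lift ?_
  rintro _ rfl
  exact ⟨c, hc, id, hL.isLift⟩

/-! ### Defining families made of good charts -/

namespace DefiningFamily

variable {X Y : Opens M}

/-- A smaller member around `p` injects into both charts, and these injections link their germs. -/
theorem compat_self (F : DefiningFamily X) : Compat F.charts F.charts := by
  intro c hc c' hc' p hp
  obtain ⟨b, hb, hpb, hs⟩ := F.refine' c hc c' hc' p hp
  obtain ⟨f, hf, -⟩ := LUS.injects_iff.1 (F.injects b hb c hc fun q hq => (hs hq).1)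
  obtain ⟨f', hf', -⟩ := LUS.injects_iff.1 (F.injects b hb c' hc' fun q hq => (hs hq).2)
  exact (hf.germIso hpb).symm.trans (hf'.germIso hpb)

/-- The good charts that are compatible with a compatible cover of `X` by charts. -/
def good (X : Opens M) (A : Set (Chart M)) (hA : Compat A A)
    (hc : ∀ p ∈ X, ∃ c ∈ A, p ∈ c.image) : DefiningFamily X where
  charts := {c | c.2.Good ∧ c.image ⊆ X ∧ Compat {c} A}
  image_subset c hc := hc.2.1
  cover p hp := by
    obtain ⟨c, hcA, hpc⟩ := hc p hp
    obtain ⟨L, h1, h2, h3, h4⟩ := c.2.exists_good_sub hpc X.isOpen hp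
    exact ⟨⟨c.1, L⟩, ⟨h1, h4, hA.of_isSub hcA h2⟩, h3⟩
  refine' := by
    rintro c₁ ⟨-, h, h'⟩ c₂ - p hp
    obtain ⟨L, h1, h2, h3, h4⟩ := c₁.2.exists_good_sub hp.1
      (c₁.isOpen_image.inter c₂.isOpen_image) hp
    exact ⟨⟨c₁.1, L⟩, ⟨h1, (h4.trans inter_subset_left).trans h, h'.of_isSub rfl h2⟩, h3, h4⟩
  injects := by
    rintro c ⟨h1, h2, h3⟩ c' ⟨-, -, h4⟩ hs
    exact h1.injects fun p hp => (h3.trans h4.symm fun d hd _ _ q hq => hc q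
      (h2 (mem_singleton_iff.1 hd ▸ hq.1))) c rfl c' rfl p ⟨hp, hs hp⟩

theorem good_compat {A : Set (Chart M)} (hA : Compat A A)
    (hc : ∀ p ∈ X, ∃ c ∈ A, p ∈ c.image) : Compat (good X A hA hc).charts A :=
  fun c hc' c' hc'' => hc'.2.2 c rfl c' hc''

/-- The good restrictions of the members of a defining family. -/
def goodSubs (F : DefiningFamily X) : Set (Chart M) :=
  {c | c.2.Good ∧ ∃ L : LUS M c.1, ⟨c.1, L⟩ ∈ F.charts ∧ c.2.IsSub L}

theorem goodSubs_compat (F : DefiningFamily X) : Compat F.goodSubs F.charts :=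
  F.compat_self.of_lift fun _ ⟨_, L, hL, hs⟩ => ⟨⟨_, L⟩, hL, id, hs.isLift⟩

theorem exists_image_subset {F : DefiningFamily X} {c : Chart M}
    (hc : c ∈ F.charts ∪ F.goodSubs) : ∃ d ∈ F.charts, c.image ⊆ d.image := by
  rcases hc with hc | ⟨-, L, hL, hs⟩
  · exact ⟨c, hc, subset_rfl⟩
  · exact ⟨⟨c.1, L⟩, hL, hs.range_subset⟩

theorem exists_goodSubs (F : DefiningFamily X) {c : Chart M} (hc : c ∈ F.charts) {p : M}
    (hp : p ∈ c.image) {O : Set M} (hO : IsOpen O) (hpO : p ∈ O) :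
    ∃ d ∈ F.goodSubs, p ∈ d.image ∧ d.image ⊆ O := by
  obtain ⟨L, h1, h2, h3, h4⟩ := c.2.exists_good_sub hp hO hpO
  exact ⟨⟨c.1, L⟩, ⟨h1, c.2, hc, h2⟩, h3, h4⟩

theorem exists_goodSubs_refine (F : DefiningFamily X) {c₁ c₂ : Chart M}
    (hc₁ : c₁ ∈ F.charts ∪ F.goodSubs) {p : M} (hp : p ∈ c₁.image ∩ c₂.image) :
    ∃ d ∈ F.goodSubs, p ∈ d.image ∧ d.image ⊆ c₁.image ∩ c₂.image := by
  obtain ⟨d, hd, hs⟩ := exists_image_subset hc₁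
  exact F.exists_goodSubs hd (hs hp.1) (c₁.isOpen_image.inter c₂.isOpen_image) hp

/-- A defining family, enlarged by the good restrictions of its members. -/
def enlarge (F : DefiningFamily X) : DefiningFamily X where
  charts := F.charts ∪ F.goodSubs
  image_subset c hc := by
    obtain ⟨d, hd, hs⟩ := exists_image_subset hc
    exact hs.trans (F.image_subset d hd)
  cover p hp := by
    obtain ⟨c, hc, h⟩ := F.cover p hp
    exact ⟨c, Or.inl hc, h⟩
  refine' c₁ hc₁ c₂ _ p hp := by
    obtain ⟨d, hd, h⟩ := F.exists_goodSubs_refine hc₁ hp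
    exact ⟨d, Or.inr hd, h⟩
  injects := by
    have hcF : Compat (F.charts ∪ F.goodSubs) F.charts := by
      rintro c (hc | hc)
      · exact F.compat_self c hc
      · exact F.goodSubs_compat c hc
    have hcc : Compat (F.charts ∪ F.goodSubs) (F.charts ∪ F.goodSubs) :=
      hcF.trans hcF.symm fun c hc c' hc' p hp => by
        obtain ⟨d, hd, hs⟩ := exists_image_subset hc
        exact ⟨d, hd, hs hp.1⟩
    -- Original members inject into restrictions by correcting an injection into the larger chart
    -- with a group element; restrictions inject into everything because they are good.
    rintro c (hc | hc) c' hc' hs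
    · rcases hc' with hc' | ⟨-, L, hL, hsub⟩
      · exact F.injects c hc c' hc' hs
      · exact hsub.injects (F.injects c hc ⟨_, L⟩ hL (hs.trans hsub.range_subset)) hs
    · exact hc.1.injects fun p hp => hcc c (Or.inr hc) c' hc' p ⟨hp, hs hp⟩

/-- The good restrictions of the members of a defining family form a defining family. -/
def shrink (F : DefiningFamily X) : DefiningFamily X where
  charts := F.goodSubs
  image_subset c hc := F.enlarge.image_subset c (Or.inr hc)
  cover p hp := by
    obtain ⟨c, hc, h⟩ := F.cover p hp
    obtain ⟨d, hd, h, -⟩ := F.exists_goodSubs hc h X.isOpen hp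
    exact ⟨d, hd, h⟩
  refine' _ hc₁ _ _ _ hp := F.exists_goodSubs_refine (Or.inr hc₁) hp
  injects c hc c' hc' hs := F.enlarge.injects c (Or.inr hc) c' (Or.inr hc') hs

theorem compat_trans {F : DefiningFamily X} {A B : Set (Chart M)} (h : Compat A F.charts)
    (h' : Compat F.charts B) (hX : ∀ c ∈ A, c.image ⊆ X) : Compat A B :=
  h.trans h' fun c hc _ _ p hp => F.cover p (hX c hc hp.1)

end DefiningFamily

open DefiningFamily

variable {X Y : Opens M}

/-! ### Equivalence as compatibility -/

/-- Equivalence of defining families is a local condition. -/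
theorem equivalent_iff {F F' : DefiningFamily X} :
    Equivalent F F' ↔ Compat F.charts F'.charts := by
  constructor
  · intro h
    induction h with
    | refl => exact F.compat_self
    | tail _ h ih =>
      obtain ⟨H, h1, h2⟩ := h
      exact compat_trans ih (H.compat_self.mono h1 h2) F.image_subset
  · intro h
    -- The chain is `F`, `F.shrink`, `F'.shrink`, `F'`. The outer links lie in the enlargements, the
    -- middle one in the family of all good charts compatible with `F`.
    have h1 : F.shrink.charts ⊆ (good X F.charts F.compat_self F.cover).charts := fun c hc =>
      ⟨hc.1, F.shrink.image_subset c hc,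
        F.goodSubs_compat.mono (singleton_subset_iff.2 hc) subset_rfl⟩
    have h2 : F'.shrink.charts ⊆ (good X F.charts F.compat_self F.cover).charts := fun c hc =>
      ⟨hc.1, F'.shrink.image_subset c hc,
        (compat_trans F'.goodSubs_compat h.symm F'.shrink.image_subset).mono
          (singleton_subset_iff.2 hc) subset_rfl⟩
    have e1 : DirectlyEquivalent F F.shrink :=
      ⟨F.enlarge, subset_union_left, subset_union_right⟩
    have e2 : DirectlyEquivalent F'.shrink F' :=
      ⟨F'.enlarge, subset_union_right, subset_union_left⟩
    exact ((Relation.ReflTransGen.single e1).tail ⟨_, h1, h2⟩).tail e2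

/-! ### Restriction and gluing of structures -/

namespace VStructure

theorem exists_mem (V : VStructure X) : ∃ F, F ∈ V.families := by
  obtain ⟨F, hF⟩ := V.isClass
  exact ⟨F, hF ▸ Relation.ReflTransGen.refl⟩

theorem mem_iff {V : VStructure X} {F F' : DefiningFamily X} (hF : F ∈ V.families) :
    F' ∈ V.families ↔ Compat F'.charts F.charts := by
  obtain ⟨F₀, hF₀⟩ := V.isClass
  rw [hF₀] at hF ⊢
  have h1 := equivalent_iff.1 hF
  refine equivalent_iff.trans ⟨fun h => ?_, fun h => ?_⟩
  · exact compat_trans h.symm h1 F'.image_subset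
  · exact compat_trans h1 h.symm F₀.image_subset

/-- Each defining family has an equivalent one with arbitrarily small members; those contained
in `Y` form a defining family on `Y`. -/
theorem exists_restrict_charts (hY : Y ≤ X) (V : VStructure X) {F : DefiningFamily X}
    (hF : F ∈ V.families) : ∃ F' ∈ V.families, ∃ K : DefiningFamily Y,
      K.charts ⊆ F'.restrict Y ∧ Compat K.charts F.charts := by
  let D := good X F.charts F.compat_self F.cover
  have hD : Compat D.charts F.charts := good_compat _ _
  have hsub : ∀ c ∈ D.charts, ∀ p ∈ c.image, ∀ O : Set M, IsOpen O → p ∈ O →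
      ∃ d ∈ D.charts, p ∈ d.image ∧ d.image ⊆ O := by
    intro c hc p hp O hO hpO
    obtain ⟨L, h1, h2, h3, h4⟩ := c.2.exists_good_sub hp hO hpO
    exact ⟨⟨c.1, L⟩, ⟨h1, h2.range_subset.trans hc.2.1, hD.of_isSub hc h2⟩, h3, h4⟩
  refine ⟨D, (mem_iff hF).2 hD, ⟨{c | c ∈ D.charts ∧ c.image ⊆ Y}, fun c hc => hc.2, ?_, ?_, ?_⟩,
    ?_, ?_⟩
  · intro p hp
    obtain ⟨c, hc, hpc⟩ := D.cover p (hY hp)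
    obtain ⟨d, hd, h1, h2⟩ := hsub c hc p hpc Y Y.isOpen hp
    exact ⟨d, ⟨hd, h2⟩, h1⟩
  · rintro c₁ ⟨hc₁, h⟩ c₂ ⟨hc₂, -⟩ p hp
    obtain ⟨d, hd, h1, h2⟩ := D.refine' c₁ hc₁ c₂ hc₂ p hp
    exact ⟨d, ⟨hd, (h2.trans inter_subset_left).trans h⟩, h1, h2⟩
  · exact fun c hc c' hc' => D.injects c hc.1 c' hc'.1
  -- A chart with image inside `Y` is its own component over `Y`.
  · exact fun c hc => ⟨c.2, hc.1, LUS.isComponent_self hc.2⟩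
  · exact hD.mono (fun c hc => hc.1) subset_rfl

/-- This removes both existential choices in the restriction: one representative `F` decides
membership, chart by chart and point by point. -/
theorem mem_restrict_iff (hY : Y ≤ X) {V : VStructure X} {F : DefiningFamily X}
    (hF : F ∈ V.families) {K : DefiningFamily Y} :
    K ∈ V.restrict Y ↔ Compat K.charts F.charts := by
  constructor
  · rintro ⟨F', hF', K₀, hK₀, hK⟩
    have h1 : Compat K₀.charts F.charts := ((mem_iff hF).1 hF').of_lift fun c hc => by
      obtain ⟨L, hL, hs⟩ := hK₀ hc
      exact ⟨⟨_, L⟩, hL, id, hs.isLift⟩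
    exact compat_trans (equivalent_iff.1 hK).symm h1 K.image_subset
  · intro h
    obtain ⟨F', hF', K₀, hK₀, hK⟩ := V.exists_restrict_charts hY hF
    exact ⟨F', hF', K₀, hK₀, equivalent_iff.2
      (compat_trans hK h.symm fun c hc => (K₀.image_subset c hc).trans hY)⟩

theorem exists_mem_restrict (hY : Y ≤ X) (V : VStructure X) : ∃ K, K ∈ V.restrict Y := by
  obtain ⟨F, hF⟩ := V.exists_mem
  obtain ⟨F', hF', K, hK, -⟩ := V.exists_restrict_charts hY hF
  exact ⟨K, F', hF', K, hK, Relation.ReflTransGen.refl⟩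

theorem isClass_restrict (hY : Y ≤ X) (V : VStructure X) : IsClass (V.restrict Y) := by
  obtain ⟨F, hF⟩ := V.exists_mem
  obtain ⟨K, hK⟩ := V.exists_mem_restrict hY
  refine ⟨K, Set.ext fun K' => ?_⟩
  have hKF := (mem_restrict_iff hY hF).1 hK
  refine (mem_restrict_iff hY hF).trans (Iff.trans ⟨fun h => ?_, fun h => ?_⟩
    equivalent_iff.symm)
  · exact compat_trans hKF h.symm fun c hc => (K.image_subset c hc).trans hY
  · exact compat_trans h.symm hKF K'.image_subset

/-- Structures whose restrictions to an open set agree are compatible over it. -/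
theorem germIso_of_restrict_eq {X' : Opens M} (hY : Y ≤ X) (hY' : Y ≤ X') {V : VStructure X}
    {V' : VStructure X'} (h : V.restrict Y = V'.restrict Y) {F : DefiningFamily X}
    (hF : F ∈ V.families) {F' : DefiningFamily X'} (hF' : F' ∈ V'.families) {c c' : Chart M}
    (hc : c ∈ F.charts) (hc' : c' ∈ F'.charts) {p : M} (hp : p ∈ c.image ∩ c'.image)
    (hpY : p ∈ Y) : c.2.GermIso c'.2 p := by
  obtain ⟨K, hK⟩ := V.exists_mem_restrict hY
  obtain ⟨k, hk, hpk⟩ := K.cover p hpY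
  exact ((mem_restrict_iff hY hF).1 hK k hk c hc p ⟨hpk, hp.1⟩).symm.trans
    ((mem_restrict_iff hY' hF').1 (h ▸ hK) k hk c' hc' p ⟨hpk, hp.2⟩)

theorem eq_of_compat {V V' : VStructure X} {F F' : DefiningFamily X} (hF : F ∈ V.families)
    (hF' : F' ∈ V'.families) (h : Compat F.charts F'.charts) : V = V' := by
  ext K
  rw [mem_iff hF', mem_iff hF]
  exact ⟨fun hK => compat_trans hK h K.image_subset,
    fun hK => compat_trans hK h.symm K.image_subset⟩

theorem eq_of_restrict_eq {𝒰 : Set (Opens M)} (h𝒰 : ∀ p : M, ∃ U ∈ 𝒰, p ∈ U)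
    {V V' : VStructure (⊤ : Opens M)} (h : ∀ U ∈ 𝒰, V.restrict U = V'.restrict U) : V = V' := by
  obtain ⟨F, hF⟩ := V.exists_mem
  obtain ⟨F', hF'⟩ := V'.exists_mem
  refine eq_of_compat hF hF' fun c hc c' hc' p hp => ?_
  obtain ⟨U, hU, hpU⟩ := h𝒰 p
  exact germIso_of_restrict_eq le_top le_top (h U hU) hF hF' hc hc' hp hpU

/-- Representatives of the given structures are pooled into one set of charts. Equality on `U ⊓ U'`
makes the pool compatible with itself, and the good charts compatible with it define the glued
structure. -/
theorem exists_glue {𝒰 : Set (Opens M)} (h𝒰 : ∀ p : M, ∃ U ∈ 𝒰, p ∈ U)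
    (W : (U : Opens M) → U ∈ 𝒰 → VStructure U)
    (hW : ∀ (U : Opens M) (hU : U ∈ 𝒰) (U' : Opens M) (hU' : U' ∈ 𝒰),
      (W U hU).restrict (U ⊓ U') = (W U' hU').restrict (U ⊓ U')) :
    ∃ V : VStructure (⊤ : Opens M), ∀ (U : Opens M) (hU : U ∈ 𝒰),
      V.restrict U = (W U hU).families := by
  choose F hF using fun U hU => (W U hU).exists_mem
  let A : Set (Chart M) := {c | ∃ U hU, c ∈ (F U hU).charts}
  have hA : Compat A A := by
    rintro c ⟨U, hU, hc⟩ c' ⟨U', hU', hc'⟩ p hp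
    exact germIso_of_restrict_eq inf_le_left inf_le_right (hW U hU U' hU') (hF U hU) (hF U' hU')
      hc hc' hp ⟨(F U hU).image_subset c hc hp.1, (F U' hU').image_subset c' hc' hp.2⟩
  have hcov : ∀ p ∈ (⊤ : Opens M), ∃ c ∈ A, p ∈ c.image := by
    intro p _
    obtain ⟨U, hU, hpU⟩ := h𝒰 p
    obtain ⟨c, hc, hpc⟩ := (F U hU).cover p hpU
    exact ⟨c, ⟨U, hU, hc⟩, hpc⟩
  let D := good ⊤ A hA hcov
  have hD : Compat D.charts A := good_compat hA hcov
  let V : VStructure (⊤ : Opens M) := ⟨{F' | Equivalent D F'}, D, rfl⟩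
  have hDV : D ∈ V.families := Relation.ReflTransGen.refl
  refine ⟨V, fun U hU => Set.ext fun K => ?_⟩
  have hDU : Compat D.charts (F U hU).charts := hD.mono subset_rfl fun c hc => ⟨U, hU, hc⟩
  rw [mem_restrict_iff le_top hDV, mem_iff (hF U hU)]
  exact ⟨fun h => compat_trans h hDU fun _ _ => subset_univ _,
    fun h => compat_trans h hDU.symm K.image_subset⟩

end VStructure

end VMfd

theorem mainTheorem4 {M : Type*} [TopologicalSpace M] [T2Space M]
    (𝒰 : Set (TopologicalSpace.Opens M)) (h𝒰 : ∀ p : M, ∃ U ∈ 𝒰, p ∈ U) :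
    -- V-manifold structures restrict to V-manifold structures
    (∀ X Y : TopologicalSpace.Opens M, Y ≤ X → ∀ V : VMfd.VStructure X,
      VMfd.IsClass (V.restrict Y)) ∧
    -- a V-manifold structure on `M` is determined by its restrictions to the sets of the cover
    (∀ V V' : VMfd.VStructure (⊤ : TopologicalSpace.Opens M),
      (∀ U ∈ 𝒰, V.restrict U = V'.restrict U) → V = V') ∧
    -- compatible V-manifold structures on the sets of the cover glue uniquely
    (∀ W : (U : TopologicalSpace.Opens M) → U ∈ 𝒰 → VMfd.VStructure U,
      (∀ (U : TopologicalSpace.Opens M) (hU : U ∈ 𝒰) (U' : TopologicalSpace.Opens M)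
        (hU' : U' ∈ 𝒰), (W U hU).restrict (U ⊓ U') = (W U' hU').restrict (U ⊓ U')) →
      ∃! V : VMfd.VStructure (⊤ : TopologicalSpace.Opens M),
        ∀ (U : TopologicalSpace.Opens M) (hU : U ∈ 𝒰), V.restrict U = (W U hU).families) :=
  ⟨fun _ _ hY V => V.isClass_restrict hY,
    fun _ _ h => VMfd.VStructure.eq_of_restrict_eq h𝒰 h,
    fun W hW => by
      obtain ⟨V, hV⟩ := VMfd.VStructure.exists_glue h𝒰 W hW
      exact ⟨V, hV, fun V' hV' => VMfd.VStructure.eq_of_restrict_eq h𝒰 fun U hU =>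
        (hV' U hU).trans (hV U hU).symm⟩⟩
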